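/- Let $a,b>-2$. For $\alpha,\beta>-1$ let $P_j^{(\alpha,\beta)}$ be the Jacobi polynomial of degree $j$, so that $\int_{-1}^{1}P_j^{(\alpha,\beta)}(x)P_k^{(\alpha,\beta)}(x)(1-x)^{\alpha}(1+x)^{\beta}\,dx=h_j^{(\alpha,\beta)}\delta_{jk}$ for all $j,k\ge 0$. For $x,y\in(-1,1)$ and $N\ge 1$ define $$\varphi_j^{(1)}(x)=\frac{P_j^{(a+1,b+1)}(x)}{\sqrt{h_j^{(a+1,b+1)}}}(1-x)^{a/2}(1+x)^{b/2},\qquad S_N^{(1)}(x,y)=\sum_{j=0}^{N-1}(1-x^2)\,\varphi_j^{(1)}(x)\,\varphi_j^{(1)}(y)$$ (the kernel $S_N^{(1)}$ of the Jacobi orthogonal ensemble), and let $K_{\mathrm{sine}}(x,y)=\dfrac{\sin(x-y)}{\pi(x-y)}$ for $x\ne y$ and $K_{\mathrm{sine}}(x,x)=\dfrac1\pi$. Then, as $N\to\infty$, $$\frac1N S_N^{(1)}\!\left(\frac xN,\frac yN\right)=K_{\mathrm{sine}}(x,y)+O(N^{-1}),$$ uniformly for $x$ and $y$ in compact subsets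 of $\mathbb R$. That is, for every compact $K\subset\mathbb R$ there are constants $C$ and $N_0\ge1$, depending only on $a,b,K$, such that $\left|\frac1N S_N^{(1)}\left(\frac xN,\frac yN\right)-K_{\mathrm{sine}}(x,y)\right|\le \frac CN$ for all integers $N\ge N_0$ and all $x,y\in K$. -/

import Mathlib

/-- The Jacobi polynomial `P_n^{(α,β)}` in its standard normalization `P_n^{(α,β)}(1) = C(n+α, n)`,
given by the classical explicit formula (with generalized binomial coefficients)
`P_n^{(α,β)}(x) = ∑_{s=0}^n C(n+α, n-s) C(n+β, s) ((x-1)/2)^s ((x+1)/2)^(n-s)`. -/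
noncomputable def jacobiPoly (α β : ℝ) (n : ℕ) (x : ℝ) : ℝ :=
  ∑ s ∈ Finset.range (n + 1),
    Ring.choose ((n : ℝ) + α) (n - s) * Ring.choose ((n : ℝ) + β) s *
      ((x - 1) / 2) ^ s * ((x + 1) / 2) ^ (n - s)

/-- The squared norm `h_n^{(α,β)}` of `P_n^{(α,β)}` for the weight `(1-x)^α (1+x)^β` on `[-1,1]`. -/
noncomputable def jacobiNormSq (α β : ℝ) (n : ℕ) : ℝ :=
  ∫ x in (-1 : ℝ)..1, jacobiPoly α β n x ^ 2 * ((1 - x) ^ α * (1 + x) ^ β)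

/-- `φ_j^{(1)}(x) = P_j^{(a+1,b+1)}(x) / √h_j^{(a+1,b+1)} · (1-x)^{a/2} (1+x)^{b/2}`. -/
noncomputable def joePhi (a b : ℝ) (j : ℕ) (x : ℝ) : ℝ :=
  jacobiPoly (a + 1) (b + 1) j x / √(jacobiNormSq (a + 1) (b + 1) j) *
    (1 - x) ^ (a / 2) * (1 + x) ^ (b / 2)

/-- The kernel `S_N^{(1)}(x,y) = ∑_{j=0}^{N-1} (1-x²) φ_j^{(1)}(x) φ_j^{(1)}(y)` of the Jacobi
orthogonal ensemble. -/
noncomputable def joeKernel (a b : ℝ) (N : ℕ) (x y : ℝ) : ℝ :=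
  ∑ j ∈ Finset.range N, (1 - x ^ 2) * joePhi a b j x * joePhi a b j y

/-- The sine kernel `sin (x-y) / (π (x-y))`, with its continuous value `1/π` on the diagonal. -/
noncomputable def sineKernel (x y : ℝ) : ℝ :=
  if x = y then 1 / Real.pi else Real.sin (x - y) / (Real.pi * (x - y))

open Polynomial Filter Topology MeasureTheory

/-! Put x = cos θ, α = a+1, β = b+1. The Liouville transform u of P_N solves u'' + (ρ² + q)u = 0 on
(0,π), with ρ = N + (α+β+1)/2 and q independent of N, and ∫ u² = h_N. This equation replaces any
asymptotic formula for P_N or any explicit value of h_N.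

A Christoffel–Darboux formula involving only P_N and P_N' (`jacobiKernel_eq`) becomes, in the
variable θ, -sin t times W = u(s)u'(t) - u(t)u'(s), plus smaller terms. As a function of s, W
vanishes at s = t, has derivative E(t) = u'² + (ρ²+q)u² there, and nearly satisfies W'' + ρ²W = 0;
hence W ≈ E(t) sin(ρ(s-t))/ρ (`exists_liouville_wronskian_bound`).

The energy comes from the virial identity (θE - uu')' = 2ρ²u² + (2q + θq')u². Although q may blow up
like θ⁻² at 0, 2q + θq' stays bounded. Integrating over (0,t), doing the same for the mirror image
over (t,π) and adding gives πE(t) = (2ρ² + O(1))h_N (`exists_liouvilleEnergy_bound`). Dividing by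
2ρh_N, the norm cancels and sin(ρ(s-t))/π remains.

Every error carries a factor |s-t|, so with s = arccos(x/N), t = arccos(y/N) one may divide by x-y
uniformly near the diagonal; the diagonal follows by continuity. -/

/-! ### Jacobi polynomials and their differential equation -/

theorem ringChoose_succ_mul (r : ℝ) (k : ℕ) :
    Ring.choose r (k + 1) * (k + 1) = Ring.choose r k * (r - k) := by
  have h := Ring.choose_smul_choose r (Nat.le_succ k)
  simp only [Nat.succ_eq_add_one, Nat.choose_succ_self_right, nsmul_eq_mul,
    Nat.add_sub_cancel_left, Ring.choose_one_right] at h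
  push_cast at h
  linarith

theorem ringChoose_add_self_pos {α : ℝ} (hα : -1 < α) (n k : ℕ) (hk : k ≤ n) :
    0 < Ring.choose ((n : ℝ) + α) k := by
  induction k with
  | zero => simp
  | succ k ih =>
    have h := ringChoose_succ_mul ((n : ℝ) + α) k
    have hkn : (k : ℝ) + 1 ≤ n := by exact_mod_cast hk
    have h1 : 0 < Ring.choose ((n : ℝ) + α) k * ((n : ℝ) + α - k) :=
      mul_pos (ih (by omega)) (by linarith)
    rw [← h] at h1
    exact (mul_pos_iff_of_pos_right (by positivity)).1 h1

/-- The Jacobi polynomial `P_n^{(α,β)}` as an element of `ℝ[X]`. -/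
noncomputable def jacobiPolynomial (α β : ℝ) (n : ℕ) : ℝ[X] :=
  ∑ s ∈ Finset.range (n + 1),
    C (Ring.choose ((n : ℝ) + α) (n - s) * Ring.choose ((n : ℝ) + β) s) *
      ((C (1 / 2) * (X - 1)) ^ s * (C (1 / 2) * (X + 1)) ^ (n - s))

theorem eval_jacobiPolynomial (α β : ℝ) (n : ℕ) (x : ℝ) :
    (jacobiPolynomial α β n).eval x = jacobiPoly α β n x := by
  simp only [jacobiPolynomial, jacobiPoly, eval_finsetSum]
  refine Finset.sum_congr rfl fun s _ => ?_
  simp only [eval_mul, eval_C, eval_pow, eval_sub, eval_add, eval_X, eval_one]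
  ring

theorem natDegree_jacobiPolynomial_le (α β : ℝ) (n : ℕ) :
    (jacobiPolynomial α β n).natDegree ≤ n := by
  refine natDegree_sum_le_of_forall_le _ _ fun s hs => ?_
  have hs' : s ≤ n := by simpa [Nat.lt_succ_iff] using hs
  refine (natDegree_C_mul_le _ _).trans ?_
  refine natDegree_mul_le.trans ?_
  have h1 : ((C (1 / 2 : ℝ) * (X - 1)) ^ s).natDegree ≤ s := by
    refine natDegree_pow_le_of_le s (m := 1) ?_ |>.trans (by simp)
    exact (natDegree_C_mul_le _ _).trans (by compute_degree)
  have h2 : ((C (1 / 2 : ℝ) * (X + 1)) ^ (n - s)).natDegree ≤ n - s := by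
    refine natDegree_pow_le_of_le (n - s) (m := 1) ?_ |>.trans (by simp)
    exact (natDegree_C_mul_le _ _).trans (by compute_degree)
  omega

theorem eval_one_jacobiPolynomial_pos {α : ℝ} (hα : -1 < α) (β : ℝ) (n : ℕ) :
    0 < (jacobiPolynomial α β n).eval 1 := by
  have : (jacobiPolynomial α β n).eval 1 = Ring.choose ((n : ℝ) + α) n := by
    rw [eval_jacobiPolynomial, jacobiPoly, Finset.sum_eq_single 0]
    · simp
    · intro s _ hs
      simp [hs]
    · simp
  rw [this]
  exact ringChoose_add_self_pos hα n n le_rfl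

/-- The Jacobi differential operator `(1-x²) f'' + (β-α-(α+β+2)x) f'`. -/
noncomputable def jacobiOperator (α β : ℝ) (f : ℝ[X]) : ℝ[X] :=
  (1 - X ^ 2) * derivative (derivative f) +
    (C (β - α) - C (α + β + 2) * X) * derivative f

/-- With T = (X-1)/2 and V = (X+1)/2 one has V - T = 1 and 1 - X² = -4TV, so only two neighbours of
lower total degree appear. The truncated exponents are harmless: their coefficients vanish at m = 0
and s = 0. -/
theorem jacobiOperator_pow_mul_pow (α β : ℝ) (s m : ℕ) :
    jacobiOperator α β ((C (1 / 2) * (X - 1)) ^ s * (C (1 / 2) * (X + 1)) ^ m) +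
      C (((s : ℝ) + m) * (s + m + α + β + 1)) *
        ((C (1 / 2) * (X - 1)) ^ s * (C (1 / 2) * (X + 1)) ^ m) =
    C ((m : ℝ) * (m + β)) * ((C (1 / 2) * (X - 1)) ^ s * (C (1 / 2) * (X + 1)) ^ (m - 1)) -
      C ((s : ℝ) * (s + α)) * ((C (1 / 2) * (X - 1)) ^ (s - 1) * (C (1 / 2) * (X + 1)) ^ m) := by
  apply Polynomial.funext
  intro x
  have key : ∀ t v : ℝ, (1 / 2) * (x - 1) = t → v = t + 1 → (1 / 2) * (x + 1) = v := by
    intro t v h1 h2; rw [h2, ← h1]; ring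
  obtain ⟨t, ht⟩ : ∃ t : ℝ, (1 / 2) * (x - 1) = t := ⟨_, rfl⟩
  have hv : (1 / 2) * (x + 1) = t + 1 := key _ _ ht rfl
  have hx : x = 2 * t + 1 := by rw [← ht]; ring
  simp only [jacobiOperator, derivative_mul, derivative_pow, derivative_add, derivative_sub,
    derivative_C, derivative_X, derivative_one, eval_add, eval_mul, eval_sub, eval_pow, eval_C,
    eval_X, eval_one, derivative_zero, eval_zero, ht, hv]
  rw [hx]
  -- Second derivatives produce exponents truncated at 0, hence the cases 0, 1 and at least 2.
  rcases s with _ | _ | s <;> rcases m with _ | _ | m <;>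
    simp only [Nat.cast_one, Nat.cast_add, Nat.add_sub_cancel, pow_zero, pow_one,
      Nat.zero_sub, zero_add, Nat.sub_self, CharP.cast_eq_zero] <;> ring

/-- The ratio of consecutive coefficients is exactly what makes the neighbour terms of
`jacobiOperator_pow_mul_pow` telescope. -/
theorem jacobiPolynomial_ode (α β : ℝ) (n : ℕ) :
    jacobiOperator α β (jacobiPolynomial α β n) +
      C ((n : ℝ) * (n + α + β + 1)) * jacobiPolynomial α β n = 0 := by
  have hop : ∀ (S : Finset ℕ) (c : ℕ → ℝ) (f : ℕ → ℝ[X]),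
      jacobiOperator α β (∑ s ∈ S, C (c s) * f s) = ∑ s ∈ S, C (c s) * jacobiOperator α β (f s) := by
    intro S c f
    simp only [jacobiOperator, derivative_sum, derivative_C_mul, Finset.mul_sum,
      ← Finset.sum_add_distrib]
    exact Finset.sum_congr rfl fun s _ => by ring
  rw [jacobiPolynomial, hop, Finset.mul_sum, ← Finset.sum_add_distrib]
  set A : ℕ → ℝ := fun s => Ring.choose ((n : ℝ) + α) (n - s) * Ring.choose ((n : ℝ) + β) s
  set T : ℝ[X] := C (1 / 2) * (X - 1)
  set V : ℝ[X] := C (1 / 2) * (X + 1)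
  -- Both ends of the telescoping sum vanish: U 0 by its factor s, U (n+1) by the cutoff.
  set U : ℕ → ℝ[X] := fun s =>
    if s ≤ n then - (C (A s * (s * (s + α))) * (T ^ (s - 1) * V ^ (n - s))) else 0 with hU
  have hA : ∀ s, s < n → A (s + 1) * ((s + 1) * (s + 1 + α)) =
      A s * (((n : ℝ) - s) * (n - s + β)) := by
    intro s hs
    obtain ⟨m, rfl⟩ := Nat.exists_eq_add_of_lt hs
    have h1 := ringChoose_succ_mul (((s + m + 1 : ℕ) : ℝ) + α) m
    have h2 := ringChoose_succ_mul (((s + m + 1 : ℕ) : ℝ) + β) s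
    have e1 : s + m + 1 - (s + 1) = m := by omega
    have e2 : s + m + 1 - s = m + 1 := by omega
    simp only [A, e1, e2]
    push_cast at h1 h2 ⊢
    have e3 : (s : ℝ) + m + 1 + α - m = s + 1 + α := by ring
    have e4 : (s : ℝ) + m + 1 + β - s = m + 1 + β := by ring
    rw [e3] at h1
    rw [e4] at h2
    linear_combination (Ring.choose ((s : ℝ) + m + 1 + β) (s + 1) * (s + 1)) * (-h1) +
      (Ring.choose ((s : ℝ) + m + 1 + α) (m + 1) * (m + 1)) * h2
  have hterm : ∀ s ∈ Finset.range (n + 1),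
      C (A s) * jacobiOperator α β (T ^ s * V ^ (n - s)) +
        C ((n : ℝ) * (n + α + β + 1)) * (C (A s) * (T ^ s * V ^ (n - s))) = U s - U (s + 1) := by
    intro s hs
    have hs' : s ≤ n := by simpa [Nat.lt_succ_iff] using hs
    have h := jacobiOperator_pow_mul_pow α β s (n - s)
    have e : ((n - s : ℕ) : ℝ) = n - s := by push_cast [hs']; ring
    rw [e, show (s : ℝ) + (n - s) = n by ring] at h
    have h2 : U (s + 1) = - (C (A s * (((n : ℝ) - s) * (n - s + β))) *
        (T ^ s * V ^ (n - s - 1))) := by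
      rcases hs'.lt_or_eq with hlt | rfl
      · rw [← hA s hlt]
        simp only [hU, if_pos (Nat.succ_le_of_lt hlt), Nat.add_sub_cancel, Nat.cast_add, Nat.cast_one, Nat.sub_sub]
      · simp [hU]
    rw [h2]
    simp only [hU, if_pos hs']
    rw [C_mul (a := A s), C_mul (a := A s)]
    linear_combination (C (A s)) * h
  rw [Finset.sum_congr rfl hterm, Finset.sum_range_sub']
  simp [hU]

/-! ### Orthogonality and expansion in Jacobi polynomials -/

/-- The Jacobi weight `(1-x)^α (1+x)^β`. -/
noncomputable def jacobiWeight (α β x : ℝ) : ℝ := (1 - x) ^ α * (1 + x) ^ β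

theorem intervalIntegrable_jacobiWeight {α β : ℝ} (hα : -1 < α) (hβ : -1 < β) :
    IntervalIntegrable (jacobiWeight α β) MeasureTheory.volume (-1) 1 := by
  have h1 : IntervalIntegrable (fun x : ℝ => (1 + x) ^ β) MeasureTheory.volume (-1) 0 := by
    have := (intervalIntegral.intervalIntegrable_rpow' (a := 0) (b := 1) hβ).comp_add_left 1
    simpa using this
  have h2 : IntervalIntegrable (fun x : ℝ => (1 - x) ^ α) MeasureTheory.volume 0 1 := by
    have := (intervalIntegral.intervalIntegrable_rpow' (a := 1) (b := 0) hα).comp_sub_left 1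
    simpa using this
  refine IntervalIntegrable.trans (b := 0) ?_ ?_
  · refine h1.continuousOn_mul (g := fun x : ℝ => (1 - x) ^ α) ?_
    rw [Set.uIcc_of_le (by norm_num)]
    exact ContinuousOn.rpow_const (by fun_prop) fun x hx => Or.inl (by linarith [hx.2])
  · refine h2.mul_continuousOn (g := fun x : ℝ => (1 + x) ^ β) ?_
    rw [Set.uIcc_of_le (by norm_num)]
    exact ContinuousOn.rpow_const (by fun_prop) fun x hx => Or.inl (by linarith [hx.1])

theorem intervalIntegrable_eval_mul_jacobiWeight {α β : ℝ} (hα : -1 < α) (hβ : -1 < β)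
    (f : ℝ[X]) :
    IntervalIntegrable (fun x => f.eval x * jacobiWeight α β x) MeasureTheory.volume (-1) 1 :=
  (intervalIntegrable_jacobiWeight hα hβ).continuousOn_mul f.continuous.continuousOn

/-- Integration of polynomials against the Jacobi weight. -/
noncomputable def jacobiFunctional {α β : ℝ} (hα : -1 < α) (hβ : -1 < β) : ℝ[X] →ₗ[ℝ] ℝ where
  toFun f := ∫ x in (-1 : ℝ)..1, f.eval x * jacobiWeight α β x
  map_add' f g := by
    rw [← intervalIntegral.integral_add (intervalIntegrable_eval_mul_jacobiWeight hα hβ f)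
      (intervalIntegrable_eval_mul_jacobiWeight hα hβ g)]
    simp only [eval_add, add_mul]
  map_smul' c f := by
    simp only [eval_smul, smul_eq_mul, mul_assoc, intervalIntegral.integral_const_mul,
      RingHom.id_apply]

section
variable {α β : ℝ} (hα : -1 < α) (hβ : -1 < β)

theorem jacobiFunctional_C_mul (c : ℝ) (f : ℝ[X]) :
    jacobiFunctional hα hβ (C c * f) = c * jacobiFunctional hα hβ f := by
  rw [← smul_eq_C_mul, map_smul, smul_eq_mul]

/-- The integrand is the derivative of f(x)(1-x)^(α+1)(1+x)^(β+1), which vanishes at ±1 because both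
exponents are positive. -/
theorem jacobiFunctional_divergence (f : ℝ[X]) :
    jacobiFunctional hα hβ ((1 - X ^ 2) * derivative f +
      (C (β - α) - C (α + β + 2) * X) * f) = 0 := by
  have h := intervalIntegral.integral_eq_sub_of_hasDeriv_right_of_le (a := -1) (b := 1)
    (f := fun x : ℝ => f.eval x * ((1 - x) ^ (α + 1) * (1 + x) ^ (β + 1)))
    (f' := fun x => ((1 - X ^ 2) * derivative f +
      (C (β - α) - C (α + β + 2) * X) * f).eval x * jacobiWeight α β x) (by norm_num) ?_ ?_
      (intervalIntegrable_eval_mul_jacobiWeight hα hβ _)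
  · rw [jacobiFunctional]
    simp only [LinearMap.coe_mk, AddHom.coe_mk]
    rw [h]
    have e1 : α + 1 ≠ 0 := by linarith
    have e2 : β + 1 ≠ 0 := by linarith
    simp [Real.zero_rpow e1, Real.zero_rpow e2]
  · refine f.continuous.continuousOn.mul (ContinuousOn.mul ?_ ?_)
    · exact ContinuousOn.rpow_const (by fun_prop) fun x hx => Or.inr (by linarith)
    · exact ContinuousOn.rpow_const (by fun_prop) fun x hx => Or.inr (by linarith)
  · intro x hx
    have p1 : 0 < 1 - x := by linarith [hx.2]
    have p2 : 0 < 1 + x := by linarith [hx.1]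
    have d1 : HasDerivAt (fun x : ℝ => (1 - x) ^ (α + 1)) (-1 * (α + 1) * (1 - x) ^ (α + 1 - 1)) x :=
      ((hasDerivAt_id x).const_sub 1).rpow_const (Or.inl p1.ne')
    have d2 : HasDerivAt (fun x : ℝ => (1 + x) ^ (β + 1)) (1 * (β + 1) * (1 + x) ^ (β + 1 - 1)) x :=
      ((hasDerivAt_id x).const_add 1).rpow_const (Or.inl p2.ne')
    have d := (f.hasDerivAt x).mul (d1.mul d2)
    refine (d.congr_deriv ?_).hasDerivWithinAt
    simp only [eval_add, eval_mul, eval_sub, eval_one, eval_pow, eval_X, eval_C, jacobiWeight,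
      Pi.mul_apply, add_sub_cancel_right, Real.rpow_add_one p1.ne', Real.rpow_add_one p2.ne']
    ring

theorem jacobiFunctional_mul_self_pos {f : ℝ[X]} (hf : f ≠ 0) :
    0 < jacobiFunctional hα hβ (f * f) := by
  have hnn : ∀ x ∈ Set.Ioo (-1 : ℝ) 1, 0 < jacobiWeight α β x := fun x hx =>
    mul_pos (Real.rpow_pos_of_pos (by linarith [hx.2]) _) (Real.rpow_pos_of_pos (by linarith [hx.1]) _)
  have hint := intervalIntegrable_eval_mul_jacobiWeight hα hβ (f * f)
  obtain ⟨x₀, hx₀, hfx⟩ : ∃ x ∈ Set.Ioo (-1 : ℝ) 1, f.eval x ≠ 0 := by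
    by_contra! hcon
    exact hf (eq_zero_of_infinite_isRoot f ((Set.Ioo_infinite (by norm_num)).mono hcon))
  change 0 < ∫ x in (-1 : ℝ)..1, (f * f).eval x * jacobiWeight α β x
  rw [intervalIntegral.integral_pos_iff_support_of_nonneg_ae' _ hint]
  · refine ⟨by norm_num, ?_⟩
    have hopen : IsOpen (Set.Ioo (-1 : ℝ) 1 ∩ {x | f.eval x ≠ 0}) :=
      isOpen_Ioo.inter (isOpen_ne_fun f.continuous continuous_const)
    refine lt_of_lt_of_le (hopen.measure_pos MeasureTheory.volume ⟨x₀, hx₀, hfx⟩)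
      (MeasureTheory.measure_mono ?_)
    rintro x ⟨hx, hx'⟩
    refine ⟨?_, Set.Ioo_subset_Ioc_self hx⟩
    simp only [Function.mem_support, eval_mul]
    exact mul_ne_zero (mul_ne_zero hx' hx') (hnn x hx).ne'
  · rw [Set.uIoc_of_le (by norm_num)]
    refine (MeasureTheory.ae_restrict_iff' measurableSet_Ioc).2 (Filter.Eventually.of_forall ?_)
    intro x hx
    simp only [eval_mul, Pi.zero_apply]
    exact mul_nonneg (mul_self_nonneg _) (mul_nonneg (Real.rpow_nonneg (by linarith [hx.2]) _)
      (Real.rpow_nonneg (by linarith [hx.1]) _))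

/-- Green's formula; the right side is symmetric in f and g, so the operator is self-adjoint. -/
theorem jacobiFunctional_operator_mul (f g : ℝ[X]) :
    jacobiFunctional hα hβ (jacobiOperator α β f * g) =
      - jacobiFunctional hα hβ ((1 - X ^ 2) * (derivative f * derivative g)) := by
  have h := jacobiFunctional_divergence hα hβ (derivative f * g)
  rw [eq_neg_iff_add_eq_zero, ← map_add, ← h, jacobiOperator, derivative_mul]
  congr 1
  ring

theorem jacobiPolynomial_orthogonal {m n : ℕ} (hmn : m ≠ n) :
    jacobiFunctional hα hβ (jacobiPolynomial α β m * jacobiPolynomial α β n) = 0 := by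
  set P := jacobiPolynomial α β m
  set Q := jacobiPolynomial α β n
  have h1 : jacobiOperator α β P = C (-((m : ℝ) * (m + α + β + 1))) * P := by
    rw [C_neg]; linear_combination jacobiPolynomial_ode α β m
  have h2 : jacobiOperator α β Q = C (-((n : ℝ) * (n + α + β + 1))) * Q := by
    rw [C_neg]; linear_combination jacobiPolynomial_ode α β n
  have e1 := jacobiFunctional_operator_mul hα hβ P Q
  have e2 := jacobiFunctional_operator_mul hα hβ Q P
  rw [mul_comm (derivative Q), ← e1, h1, h2, mul_assoc, mul_assoc, jacobiFunctional_C_mul,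
    jacobiFunctional_C_mul, mul_comm Q P] at e2
  have e3 : ((m : ℝ) - n) * (m + n + α + β + 1) * jacobiFunctional hα hβ (P * Q) = 0 := by
    linear_combination e2
  have p1 : (m : ℝ) - n ≠ 0 := sub_ne_zero.2 (by exact_mod_cast hmn)
  -- With α + β > -2 this makes m+n+α+β+1 positive, so the eigenvalues differ.
  have p2 : (1 : ℝ) ≤ m + n := by exact_mod_cast (by omega : 1 ≤ m + n)
  rcases mul_eq_zero.1 e3 with h | h
  · rcases mul_eq_zero.1 h with h | h
    · exact absurd h p1
    · linarith
  · exact h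

theorem jacobiFunctional_mul_self_jacobiPolynomial_pos (n : ℕ) :
    0 < jacobiFunctional hα hβ (jacobiPolynomial α β n * jacobiPolynomial α β n) := by
  refine jacobiFunctional_mul_self_pos hα hβ fun h => ?_
  have := eval_one_jacobiPolynomial_pos hα β n
  simp [h] at this

theorem jacobiNormSq_eq_functional (n : ℕ) :
    jacobiNormSq α β n =
      jacobiFunctional hα hβ (jacobiPolynomial α β n * jacobiPolynomial α β n) := by
  change _ = ∫ x in (-1 : ℝ)..1, _
  simp only [jacobiNormSq, eval_mul, eval_jacobiPolynomial, jacobiWeight, sq]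

theorem jacobiNormSq_pos {α β : ℝ} (hα : -1 < α) (hβ : -1 < β) (n : ℕ) : 0 < jacobiNormSq α β n := by
  rw [jacobiNormSq_eq_functional hα hβ]
  exact jacobiFunctional_mul_self_jacobiPolynomial_pos hα hβ n

/-- Orthogonality and positive norms give N independent elements in the N-dimensional space of
polynomials of degree less than N. No leading coefficient has to be computed. -/
theorem eq_sum_jacobiPolynomial {N : ℕ} {f : ℝ[X]} (hf : f.degree < N) :
    f = ∑ j ∈ Finset.range N, C (jacobiFunctional hα hβ (f * jacobiPolynomial α β j) /
      jacobiNormSq α β j) * jacobiPolynomial α β j := by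
  have hmem : f ∈ Submodule.span ℝ (Set.range fun j : Fin N => jacobiPolynomial α β j) := by
    have hli : LinearIndependent ℝ (fun j : Fin N => jacobiPolynomial α β j) := by
      rw [Fintype.linearIndependent_iff]
      intro g hg i
      have := congrArg (fun q => jacobiFunctional hα hβ (q * jacobiPolynomial α β i)) hg
      simp only [Finset.sum_mul, map_sum, smul_mul_assoc, map_smul, zero_mul, map_zero] at this
      rw [Finset.sum_eq_single i] at this
      · rcases smul_eq_zero.1 this with h | h
        · exact h
        · exact absurd h (jacobiFunctional_mul_self_jacobiPolynomial_pos hα hβ i).ne'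
      · intro j _ hj
        rw [jacobiPolynomial_orthogonal hα hβ (fun h => hj (Fin.ext h)), smul_zero]
      · simp
    have hle : Submodule.span ℝ (Set.range fun j : Fin N => jacobiPolynomial α β j) ≤
        degreeLT ℝ N := by
      rw [Submodule.span_le]
      rintro _ ⟨j, rfl⟩
      rw [SetLike.mem_coe, mem_degreeLT]
      exact (degree_le_of_natDegree_le (natDegree_jacobiPolynomial_le α β j)).trans_lt
        (by exact_mod_cast j.2)
    have hfd : Module.Finite ℝ (degreeLT ℝ N) := Module.Finite.equiv (degreeLTEquiv ℝ N).symm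
    rw [Submodule.eq_of_le_of_finrank_eq hle ?_]
    · exact mem_degreeLT.2 hf
    · rw [finrank_span_eq_card hli, (degreeLTEquiv ℝ N).finrank_eq]
      simp
  obtain ⟨c, hc⟩ := (Submodule.mem_span_range_iff_exists_fun ℝ).1 hmem
  have hcoef : ∀ i : Fin N, jacobiFunctional hα hβ (f * jacobiPolynomial α β i) /
      jacobiNormSq α β i = c i := by
    intro i
    rw [← hc, div_eq_iff (jacobiNormSq_pos hα hβ _).ne', jacobiNormSq_eq_functional hα hβ]
    simp only [Finset.sum_mul, map_sum, smul_mul_assoc, map_smul]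
    rw [Finset.sum_eq_single i]
    · rfl
    · intro j _ hj
      rw [jacobiPolynomial_orthogonal hα hβ (fun h => hj (Fin.ext h)), smul_zero]
    · simp
  rw [Finset.sum_range]
  simp only [hcoef, ← smul_eq_C_mul, hc]

theorem jacobiFunctional_jacobiPolynomial_mul_eq_zero {N : ℕ} {f : ℝ[X]} (hf : f.degree < N) :
    jacobiFunctional hα hβ (jacobiPolynomial α β N * f) = 0 := by
  rw [eq_sum_jacobiPolynomial hα hβ hf, Finset.mul_sum, map_sum]
  refine Finset.sum_eq_zero fun j hj => ?_
  rw [mul_left_comm, jacobiFunctional_C_mul,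
    jacobiPolynomial_orthogonal hα hβ (Finset.mem_range.1 hj).ne', mul_zero]

end

/-! ### A Christoffel–Darboux formula in P_N and its derivative -/

/-- The coefficients of X^(m+1) in -X²f' and mXf cancel. -/
theorem natDegree_one_sub_sq_mul_derivative_add_le {f : ℝ[X]} {m : ℕ} (hf : f.natDegree ≤ m) :
    ((1 - X ^ 2) * derivative f + C (m : ℝ) * (X * f)).natDegree ≤ m := by
  rw [natDegree_le_iff_coeff_eq_zero]
  intro k hk
  have hz : ∀ j, m < j → f.coeff j = 0 := fun j hj => coeff_eq_zero_of_natDegree_lt (hf.trans_lt hj)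
  rw [sub_mul, one_mul, coeff_add, coeff_sub, coeff_C_mul, coeff_derivative, hz (k + 1) (by omega)]
  rcases k with _ | _ | k
  · omega
  · have : m = 0 := by omega
    rw [mul_comm (X ^ 2), coeff_mul_X_pow']
    simp [this]
  · rw [mul_comm (X ^ 2), coeff_mul_X_pow, coeff_X_mul, coeff_derivative]
    rcases (by omega : m = k + 1 ∨ m < k + 1) with h | h
    · rw [h]; push_cast; ring
    · rw [hz _ h]; ring

/-- The Christoffel–Darboux kernel `∑_{j<N} P_j(x) P_j(y) / h_j` of the Jacobi weight. -/
noncomputable def jacobiKernel (α β : ℝ) (N : ℕ) (x y : ℝ) : ℝ :=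
  ∑ j ∈ Finset.range N, (jacobiPolynomial α β j).eval x * (jacobiPolynomial α β j).eval y /
    jacobiNormSq α β j

theorem degree_lt_natCast_of_natDegree_lt {f : ℝ[X]} {N : ℕ} (h : f.natDegree < N) : f.degree < N :=
  degree_le_natDegree.trans_lt (by exact_mod_cast h)

/-- A Christoffel–Darboux formula involving only `P_N` and its derivative. -/
theorem jacobiKernel_eq {α β : ℝ} (hα : -1 < α) (hβ : -1 < β) {N : ℕ} (hN : 0 < N) (x y : ℝ) :
    (2 * N + α + β + 1) * jacobiNormSq α β N * (x - y) * jacobiKernel α β N x y =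
      (1 - y ^ 2) * (jacobiPolynomial α β N).eval x * (derivative (jacobiPolynomial α β N)).eval y -
      (1 - x ^ 2) * (jacobiPolynomial α β N).eval y * (derivative (jacobiPolynomial α β N)).eval x -
      N * (x - y) * (jacobiPolynomial α β N).eval x * (jacobiPolynomial α β N).eval y := by
  set P := jacobiPolynomial α β N with hP
  set h := jacobiNormSq α β N with hh
  have hPdeg : P.natDegree ≤ N := natDegree_jacobiPolynomial_le α β N
  have hP0 : P ≠ 0 := by
    intro h0
    have := eval_one_jacobiPolynomial_pos hα β N
    rw [← hP, h0] at this
    simp at this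
  let J := jacobiFunctional hα hβ
  have hJ : ∀ f : ℝ[X], f.natDegree < N → J (P * f) = 0 := fun f hf =>
    jacobiFunctional_jacobiPolynomial_mul_eq_zero hα hβ (degree_lt_natCast_of_natDegree_lt hf)
  have hJC : ∀ (c : ℝ) (f : ℝ[X]), J (C c * f) = c * J f := jacobiFunctional_C_mul hα hβ
  have hJP : J (P * P) = h := (jacobiNormSq_eq_functional hα hβ N).symm
  have hdiv : ∀ r : ℝ[X], J ((1 - X ^ 2) * derivative P * r) =
      - J (P * ((1 - X ^ 2) * derivative r + (C (β - α) - C (α + β + 2) * X) * r)) := by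
    intro r
    have := jacobiFunctional_divergence hα hβ (P * r)
    rw [eq_neg_iff_add_eq_zero, ← map_add, ← this, derivative_mul]
    congr 1
    ring
  have hmain : ∀ y : ℝ, P.eval y ≠ 0 → ∀ x : ℝ,
      (2 * N + α + β + 1) * h * (x - y) * jacobiKernel α β N x y =
      (1 - y ^ 2) * P.eval x * (derivative P).eval y -
      (1 - x ^ 2) * P.eval y * (derivative P).eval x - N * (x - y) * P.eval x * P.eval y := by
    clear x y
    intro y hy x
    -- R is the claimed numerator. It vanishes at y, and its N-term cancels the degree N+1 part, so
    -- L = R/(X-y) has degree less than N. It remains to see that L is J(L) times the reproducing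
    -- kernel at y.
    set R : ℝ[X] := C ((1 - y ^ 2) * (derivative P).eval y) * P -
      C (P.eval y) * ((1 - X ^ 2) * derivative P) - C (N * P.eval y) * ((X - C y) * P) with hR
    have hRy : R.IsRoot y := by
      simp only [IsRoot, hR, eval_sub, eval_mul, eval_C, eval_pow, eval_one, eval_X]
      ring
    have hRdeg : R.natDegree ≤ N := by
      have e : R = C ((1 - y ^ 2) * (derivative P).eval y + N * P.eval y * y) * P -
          C (P.eval y) * ((1 - X ^ 2) * derivative P + C (N : ℝ) * (X * P)) := by
        rw [hR]
        simp only [C_add, C_mul]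
        ring
      rw [e]
      refine (natDegree_sub_le _ _).trans (max_le ?_ ?_)
      · exact (natDegree_C_mul_le _ _).trans hPdeg
      · exact (natDegree_C_mul_le _ _).trans (natDegree_one_sub_sq_mul_derivative_add_le hPdeg)
    set L := R /ₘ (X - C y) with hL
    have hXL : (X - C y) * L = R := mul_divByMonic_eq_iff_isRoot.2 hRy
    have hLdeg : L.natDegree < N := by
      rw [hL, natDegree_divByMonic _ (monic_X_sub_C y), natDegree_X_sub_C]
      omega
    have hquot : ∀ q : ℝ[X], ∃ r : ℝ[X], q = C (q.eval y) + (X - C y) * r ∧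
        r.natDegree = q.natDegree - 1 := by
      intro q
      refine ⟨q /ₘ (X - C y), ?_, ?_⟩
      · rw [← modByMonic_X_sub_C_eq_C_eval, modByMonic_add_div]
      · rw [natDegree_divByMonic _ (monic_X_sub_C y), natDegree_X_sub_C]
    have hsplit : ∀ q r : ℝ[X], q = C (q.eval y) + (X - C y) * r →
        J (L * q) = q.eval y * J L + J (R * r) := by
      intro q r hqr
      rw [← hJC, ← map_add, ← hXL]
      conv_lhs => rw [hqr]
      congr 1
      ring
    have hRr : ∀ r : ℝ[X], J (R * r) = (1 - y ^ 2) * (derivative P).eval y * J (P * r) -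
        P.eval y * J ((1 - X ^ 2) * derivative P * r) -
        N * P.eval y * J (P * ((X - C y) * r)) := by
      intro r
      rw [← hJC, ← hJC, ← hJC, ← map_sub, ← map_sub, hR]
      congr 1
      ring
    -- The constant is found by testing L against P itself: J(LP) = 0 by degree, and the expansion
    -- of P about y then determines J(L), provided P(y) ≠ 0.
    have hM : J L = (2 * N + α + β + 1) * h := by
      obtain ⟨r, hr, hrdeg⟩ := hquot P
      have hrN : r.natDegree ≤ N - 1 := by omega
      have e1 := hsplit P r hr
      rw [mul_comm L P, hJ L hLdeg, hRr, hJ r (by omega)] at e1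
      have e2 : J (P * ((X - C y) * r)) = h := by
        have : (X - C y) * r = P - C (P.eval y) := by rw [eq_sub_iff_add_eq']; exact hr.symm
        rw [this, mul_sub, map_sub, hJP, hJ _ (by rw [natDegree_C]; exact hN), sub_zero]
      have e3 : J (P * (X * r)) = h := by
        have : P * (X * r) = P * ((X - C y) * r) + C y * (P * r) := by ring
        rw [this, map_add, hJC, e2, hJ r (by omega), mul_zero, add_zero]
      have e4 : J ((1 - X ^ 2) * derivative P * r) = (N + α + β + 1) * h := by
        rw [hdiv]
        have : P * ((1 - X ^ 2) * derivative r + (C (β - α) - C (α + β + 2) * X) * r) =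
            P * ((1 - X ^ 2) * derivative r + C ((N - 1 : ℕ) : ℝ) * (X * r)) +
            C (β - α) * (P * r) - C (N + α + β + 1) * (P * (X * r)) := by
          have hc : (C ((N - 1 : ℕ) : ℝ) : ℝ[X]) = C (N : ℝ) - 1 := by
            rw [Nat.cast_sub hN, C_sub]; simp
          rw [hc]
          simp only [C_add, C_sub, C_1, show (2 : ℝ) = 1 + 1 by norm_num]
          ring
        rw [this, map_sub, map_add, hJC, hJC, e3, hJ r (by omega),
          hJ _ ((natDegree_one_sub_sq_mul_derivative_add_le hrN).trans_lt (by omega))]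
        ring
      rw [e2, e4] at e1
      have : P.eval y * (J L - (2 * N + α + β + 1) * h) = 0 := by linear_combination -e1
      rcases mul_eq_zero.1 this with h0 | h0
      · exact absurd h0 hy
      · linarith
    -- Reproducing property: after integration by parts, every term of J(R·r) pairs P with a
    -- polynomial of degree less than N.
    have hLq : ∀ q : ℝ[X], q.natDegree < N → J (L * q) = q.eval y * J L := by
      intro q hq
      obtain ⟨r, hr, hrdeg⟩ := hquot q
      -- For constant q the truncated degree of r would not drop below that of q, and the degree
      -- count would fail at N = 1.
      by_cases hq0 : q.natDegree = 0
      · obtain ⟨c, rfl⟩ := natDegree_eq_zero.1 hq0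
        rw [mul_comm, hJC, eval_C]
      rw [hsplit q r hr, hRr, hdiv, hJ r (by omega), hJ, hJ]
      · ring
      · refine natDegree_mul_le.trans_lt ?_
        rw [natDegree_X_sub_C]; omega
      · have e : (1 - X ^ 2) * derivative r + (C (β - α) - C (α + β + 2) * X) * r =
            ((1 - X ^ 2) * derivative r + C (r.natDegree : ℝ) * (X * r)) +
              (C (β - α) - C (r.natDegree + (α + β + 2)) * X) * r := by
          simp only [C_add]; ring
        rw [e]
        refine (natDegree_add_le _ _).trans_lt (max_lt ?_ ?_)
        · exact (natDegree_one_sub_sq_mul_derivative_add_le le_rfl).trans_lt (by omega)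
        · refine natDegree_mul_le.trans_lt ?_
          have : (C (β - α) - C (r.natDegree + (α + β + 2)) * X : ℝ[X]).natDegree ≤ 1 := by
            compute_degree
          omega
    have hLsum := eq_sum_jacobiPolynomial hα hβ (degree_lt_natCast_of_natDegree_lt hLdeg)
    have hLx : L.eval x = J L * jacobiKernel α β N x y := by
      conv_lhs => rw [hLsum]
      rw [eval_finsetSum, jacobiKernel, Finset.mul_sum]
      refine Finset.sum_congr rfl fun j hj => ?_
      have := hLq (jacobiPolynomial α β j)
        ((natDegree_jacobiPolynomial_le α β j).trans_lt (Finset.mem_range.1 hj))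
      change J _ = _ at this
      change eval x (C (J _ / _) * _) = _
      rw [this, eval_mul, eval_C]
      ring
    have hx := congrArg (eval x) hXL
    rw [eval_mul, hLx, hM, hR] at hx
    simp only [eval_sub, eval_mul, eval_C, eval_pow, eval_one, eval_X] at hx
    linear_combination hx
  -- Both sides are continuous in y, so the finitely many roots of P may be restored.
  have hdense : Dense {y : ℝ | P.eval y ≠ 0} := by
    have := (finite_setOfPred_isRoot hP0).countable.dense_compl ℝ
    exact this
  have hext := Continuous.ext_on hdense
    (f := fun y => (2 * N + α + β + 1) * h * (x - y) * jacobiKernel α β N x y)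
    (g := fun y => (1 - y ^ 2) * P.eval x * (derivative P).eval y -
      (1 - x ^ 2) * P.eval y * (derivative P).eval x - N * (x - y) * P.eval x * P.eval y)
    (by unfold jacobiKernel; fun_prop) (by fun_prop) (fun y hy => hmain y hy x)
  exact congrFun hext y

/-! ### The Liouville normal form -/

/-- The amplitude `(1-cos θ)^{(α+1/2)/2} (1+cos θ)^{(β+1/2)/2}` of the Liouville transform. -/
noncomputable def liouvilleAmp (α β θ : ℝ) : ℝ :=
  (1 - Real.cos θ) ^ ((α + 1 / 2) / 2) * (1 + Real.cos θ) ^ ((β + 1 / 2) / 2)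

/-- The logarithmic derivative of `liouvilleAmp`. -/
noncomputable def liouvilleLogDeriv (α β θ : ℝ) : ℝ :=
  (α + 1 / 2) / 2 * (Real.sin θ / (1 - Real.cos θ)) -
    (β + 1 / 2) / 2 * (Real.sin θ / (1 + Real.cos θ))

/-- The Liouville transform of a polynomial. -/
noncomputable def liouville (α β : ℝ) (P : ℝ[X]) (θ : ℝ) : ℝ :=
  liouvilleAmp α β θ * P.eval (Real.cos θ)

/-- The derivative of `liouville α β P`. -/
noncomputable def liouvilleDeriv (α β : ℝ) (P : ℝ[X]) (θ : ℝ) : ℝ :=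
  liouvilleAmp α β θ * (liouvilleLogDeriv α β θ * P.eval (Real.cos θ) -
    Real.sin θ * (derivative P).eval (Real.cos θ))

/-- The potential in the Liouville normal form `u'' + (ρ² + q) u = 0` of the Jacobi equation. -/
noncomputable def liouvillePotential (α β θ : ℝ) : ℝ :=
  (1 / 4 - α ^ 2) / (2 * (1 - Real.cos θ)) + (1 / 4 - β ^ 2) / (2 * (1 + Real.cos θ))

/-- The derivative of `liouvillePotential α β`. -/
noncomputable def liouvillePotentialDeriv (α β θ : ℝ) : ℝ :=
  -((1 / 4 - α ^ 2) * Real.sin θ / (2 * (1 - Real.cos θ) ^ 2)) +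
    (1 / 4 - β ^ 2) * Real.sin θ / (2 * (1 + Real.cos θ) ^ 2)

theorem one_sub_cos_pos {θ : ℝ} (h : θ ∈ Set.Ioo 0 Real.pi) : 0 < 1 - Real.cos θ := by
  have := Real.cos_lt_cos_of_nonneg_of_le_pi le_rfl h.2.le h.1
  rw [Real.cos_zero] at this
  linarith

theorem one_add_cos_pos {θ : ℝ} (h : θ ∈ Set.Ioo 0 Real.pi) : 0 < 1 + Real.cos θ := by
  have := Real.cos_lt_cos_of_nonneg_of_le_pi h.1.le le_rfl h.2
  rw [Real.cos_pi] at this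
  linarith

theorem hasDerivAt_liouvilleAmp (α β : ℝ) {θ : ℝ} (h : θ ∈ Set.Ioo 0 Real.pi) :
    HasDerivAt (liouvilleAmp α β) (liouvilleAmp α β θ * liouvilleLogDeriv α β θ) θ := by
  have p1 := one_sub_cos_pos h
  have p2 := one_add_cos_pos h
  have d1 := ((Real.hasDerivAt_cos θ).const_sub 1).rpow_const (p := (α + 1 / 2) / 2)
    (Or.inl p1.ne')
  have d2 := ((Real.hasDerivAt_cos θ).const_add 1).rpow_const (p := (β + 1 / 2) / 2)
    (Or.inl p2.ne')
  refine (d1.mul d2).congr_deriv ?_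
  rw [Real.rpow_sub_one p1.ne', Real.rpow_sub_one p2.ne', liouvilleAmp, liouvilleLogDeriv]
  field_simp
  ring

theorem hasDerivAt_liouvilleLogDeriv (α β : ℝ) {θ : ℝ} (h : θ ∈ Set.Ioo 0 Real.pi) :
    HasDerivAt (liouvilleLogDeriv α β) (-((α + 1 / 2) / 2 / (1 - Real.cos θ)) -
      (β + 1 / 2) / 2 / (1 + Real.cos θ)) θ := by
  have p1 := one_sub_cos_pos h
  have p2 := one_add_cos_pos h
  have d1 := ((Real.hasDerivAt_sin θ).div ((Real.hasDerivAt_cos θ).const_sub 1) p1.ne').const_mul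
    ((α + 1 / 2) / 2)
  have d2 := ((Real.hasDerivAt_sin θ).div ((Real.hasDerivAt_cos θ).const_add 1) p2.ne').const_mul
    ((β + 1 / 2) / 2)
  refine (d1.sub d2).congr_deriv ?_
  have e1 : (Real.cos θ * (1 - Real.cos θ) - Real.sin θ * -(-Real.sin θ)) / (1 - Real.cos θ) ^ 2 =
      -(1 / (1 - Real.cos θ)) := by
    field_simp
    nlinarith [Real.sin_sq_add_cos_sq θ]
  have e2 : (Real.cos θ * (1 + Real.cos θ) - Real.sin θ * -Real.sin θ) / (1 + Real.cos θ) ^ 2 =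
      1 / (1 + Real.cos θ) := by
    field_simp
    nlinarith [Real.sin_sq_add_cos_sq θ]
  rw [e1, e2]
  ring

theorem hasDerivAt_liouville (α β : ℝ) (P : ℝ[X]) {θ : ℝ} (h : θ ∈ Set.Ioo 0 Real.pi) :
    HasDerivAt (liouville α β P) (liouvilleDeriv α β P θ) θ := by
  have d := (hasDerivAt_liouvilleAmp α β h).mul
    ((P.hasDerivAt (Real.cos θ)).comp θ (Real.hasDerivAt_cos θ))
  refine d.congr_deriv ?_
  simp only [liouvilleDeriv, Function.comp]
  ring

/-- The Riccati equation w' + w² + q = -((α+β+1)/2)² for the logarithmic derivative w, with -w'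
written out as in `hasDerivAt_liouvilleLogDeriv`. -/
theorem liouvilleLogDeriv_sq_add_potential (α β : ℝ) {θ : ℝ} (h : θ ∈ Set.Ioo 0 Real.pi) :
    liouvilleLogDeriv α β θ ^ 2 + liouvillePotential α β θ =
      (α + 1 / 2) / 2 / (1 - Real.cos θ) + (β + 1 / 2) / 2 / (1 + Real.cos θ) -
        ((α + β + 1) / 2) ^ 2 := by
  have p1 := one_sub_cos_pos h
  have p2 := one_add_cos_pos h
  have hs : Real.sin θ ^ 2 = (1 - Real.cos θ) * (1 + Real.cos θ) := by
    nlinarith [Real.sin_sq_add_cos_sq θ]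
  have e : liouvilleLogDeriv α β θ ^ 2 = Real.sin θ ^ 2 * ((α + 1 / 2) / 2 / (1 - Real.cos θ) -
      (β + 1 / 2) / 2 / (1 + Real.cos θ)) ^ 2 := by
    rw [liouvilleLogDeriv]; ring
  rw [e, hs, liouvillePotential]
  field_simp
  ring

/-- The amplitude is chosen to cancel the first-order term of the Jacobi equation (`hω` below); the
Riccati equation supplies the potential and the shift from l to ρ². -/
theorem hasDerivAt_liouvilleDeriv {α β ρ l : ℝ} {P : ℝ[X]}
    (hode : jacobiOperator α β P + C l * P = 0) (hρ : ρ ^ 2 = l + ((α + β + 1) / 2) ^ 2)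
    {θ : ℝ} (h : θ ∈ Set.Ioo 0 Real.pi) :
    HasDerivAt (liouvilleDeriv α β P)
      (-(ρ ^ 2 + liouvillePotential α β θ) * liouville α β P θ) θ := by
  have dc := Real.hasDerivAt_cos θ
  have d := (hasDerivAt_liouvilleAmp α β h).mul
    (((hasDerivAt_liouvilleLogDeriv α β h).mul ((P.hasDerivAt (Real.cos θ)).comp θ dc)).sub
    ((Real.hasDerivAt_sin θ).mul (((derivative P).hasDerivAt (Real.cos θ)).comp θ dc)))
  refine d.congr_deriv ?_
  have p1 := one_sub_cos_pos h
  have p2 := one_add_cos_pos h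
  have hs : Real.sin θ ^ 2 = 1 - Real.cos θ ^ 2 := by
    nlinarith [Real.sin_sq_add_cos_sq θ]
  have ho := congrArg (eval (Real.cos θ)) hode
  simp only [jacobiOperator, eval_add, eval_mul, eval_sub, eval_pow, eval_C, eval_one, eval_X,
    eval_zero] at ho
  have hq := liouvilleLogDeriv_sq_add_potential α β h
  have hω : 2 * liouvilleLogDeriv α β θ * Real.sin θ =
      (α - β) + (α + β + 1) * Real.cos θ := by
    have : 2 * liouvilleLogDeriv α β θ * Real.sin θ = Real.sin θ ^ 2 *
      ((α + 1 / 2) / (1 - Real.cos θ) - (β + 1 / 2) / (1 + Real.cos θ)) := by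
      rw [liouvilleLogDeriv]; ring
    rw [this, hs]
    field_simp
    ring
  simp only [Function.comp, Pi.mul_apply, Pi.sub_apply, liouville]
  rw [hρ]
  set w := liouvilleLogDeriv α β θ
  set A := liouvilleAmp α β θ
  set c := Real.cos θ
  set S := Real.sin θ
  set P0 := eval c P
  set P1 := eval c (derivative P)
  set P2 := eval c (derivative (derivative P))
  linear_combination (A * P0) * hq + A * ho - A * P1 * hω + A * P2 * hs

theorem hasDerivAt_liouvillePotential (α β : ℝ) {θ : ℝ} (h : θ ∈ Set.Ioo 0 Real.pi) :
    HasDerivAt (liouvillePotential α β) (liouvillePotentialDeriv α β θ) θ := by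
  have p1 := one_sub_cos_pos h
  have p2 := one_add_cos_pos h
  have d1 := (hasDerivAt_const θ (1 / 4 - α ^ 2)).div
    (((Real.hasDerivAt_cos θ).const_sub 1).const_mul 2) (by positivity)
  have d2 := (hasDerivAt_const θ (1 / 4 - β ^ 2)).div
    (((Real.hasDerivAt_cos θ).const_add 1).const_mul 2) (by positivity)
  refine (d1.add d2).congr_deriv ?_
  rw [liouvillePotentialDeriv]
  field_simp
  ring

/-! ### The virial identity and the singular endpoint -/

/-- The energy `u'² + (ρ² + q) u²`. -/
noncomputable def liouvilleEnergy (α β ρ : ℝ) (P : ℝ[X]) (θ : ℝ) : ℝ :=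
  liouvilleDeriv α β P θ ^ 2 + (ρ ^ 2 + liouvillePotential α β θ) * liouville α β P θ ^ 2

/-- The virial `θ (u'² + (ρ² + q) u²) - u u'`. -/
noncomputable def liouvilleVirial (α β ρ : ℝ) (P : ℝ[X]) (θ : ℝ) : ℝ :=
  θ * liouvilleEnergy α β ρ P θ - liouville α β P θ * liouvilleDeriv α β P θ

/-- E' = q'u² since u solves the equation, and the u'² terms of E and (uu')' cancel. -/
theorem hasDerivAt_liouvilleVirial {α β ρ l : ℝ} {P : ℝ[X]}
    (hode : jacobiOperator α β P + C l * P = 0) (hρ : ρ ^ 2 = l + ((α + β + 1) / 2) ^ 2)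
    {θ : ℝ} (h : θ ∈ Set.Ioo 0 Real.pi) :
    HasDerivAt (liouvilleVirial α β ρ P)
      (2 * ρ ^ 2 * liouville α β P θ ^ 2 + (2 * liouvillePotential α β θ +
        θ * liouvillePotentialDeriv α β θ) * liouville α β P θ ^ 2) θ := by
  have du := hasDerivAt_liouville α β P h
  have dv := hasDerivAt_liouvilleDeriv hode hρ h
  have dq := hasDerivAt_liouvillePotential α β h
  have d := ((hasDerivAt_id θ).mul ((dv.pow 2).add ((dq.const_add (ρ ^ 2)).mul (du.pow 2)))).sub
    (du.mul dv)
  refine d.congr_deriv ?_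
  simp only [id, Pi.add_apply, Pi.mul_apply, Pi.pow_apply]
  push_cast
  ring

theorem one_sub_cos_ge {θ : ℝ} (h : |θ| ≤ Real.pi) : θ ^ 2 / 5 ≤ 1 - Real.cos θ := by
  have h1 := Real.cos_le_one_sub_mul_cos_sq h
  have h2 : 1 / 5 ≤ 2 / Real.pi ^ 2 := by
    rw [div_le_div_iff₀ (by norm_num) (by positivity)]
    nlinarith [Real.pi_lt_d2, Real.pi_pos]
  nlinarith [sq_nonneg θ]

theorem one_add_cos_ge {θ : ℝ} (h0 : 0 ≤ θ) (h : θ ≤ 5 / 2) : 1 / 20 ≤ 1 + Real.cos θ := by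
  have hp := Real.pi_gt_d2
  have h1 := one_sub_cos_ge (θ := Real.pi - θ) (by rw [abs_of_nonneg (by linarith)]; linarith)
  rw [Real.cos_pi_sub] at h1
  nlinarith

/-- The θ² terms of the two Taylor expansions cancel. -/
theorem abs_two_mul_one_sub_cos_sub_le {θ : ℝ} (h : 0 < θ) :
    |2 * (1 - Real.cos θ) - θ * Real.sin θ| ≤ 5 * θ ^ 4 := by
  rcases le_total θ 1 with h1 | h1
  · have hθ : |θ| ≤ 1 := by rwa [abs_of_pos h]
    have hc := abs_le.1 (Real.cos_bound hθ)
    have hs := abs_le.1 (Real.sin_bound hθ)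
    rw [abs_of_pos h] at hc hs
    have h5 : θ ^ 5 ≤ θ ^ 4 := pow_le_pow_of_le_one h.le h1 (by norm_num)
    have h4 : 0 ≤ θ ^ 4 := by positivity
    have k1 := mul_le_mul_of_nonneg_left hs.1 h.le
    have k2 := mul_le_mul_of_nonneg_left hs.2 h.le
    rw [abs_le]
    constructor <;> nlinarith
  · have h4 : θ ≤ θ ^ 4 := le_self_pow₀ h1 (by norm_num)
    have hc := abs_le.1 (Real.abs_cos_le_one θ)
    have hs := abs_le.1 (Real.abs_sin_le_one θ)
    rw [abs_le]
    constructor <;> nlinarith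

/-- The operator 2 + θ d/dθ annihilates θ⁻², the leading singularity of the potential at 0. The
endpoint 5/2 < π leaves room for both t and π - t when t ∈ [1,2]. -/
theorem exists_potential_virial_bound (α β : ℝ) : ∃ M : ℝ, 0 ≤ M ∧ ∀ θ ∈ Set.Ioc (0 : ℝ) (5 / 2),
    |2 * liouvillePotential α β θ + θ * liouvillePotentialDeriv α β θ| ≤ M := by
  -- 63 exceeds 5θ⁴ / (2(θ²/5)²) = 62.5, and 1300 = (13/2) / (2(1/20)²).
  refine ⟨|1 / 4 - α ^ 2| * 63 + |1 / 4 - β ^ 2| * 1300, by positivity, fun θ hθ => ?_⟩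
  have hp := Real.pi_gt_d2
  have hθ' : θ ∈ Set.Ioo 0 Real.pi := ⟨hθ.1, by linarith [hθ.2]⟩
  have p1 := one_sub_cos_pos hθ'
  have p2 := one_add_cos_pos hθ'
  have g1 := one_sub_cos_ge (θ := θ) (by rw [abs_of_pos hθ.1]; exact hθ'.2.le)
  have g2 := one_add_cos_ge hθ.1.le hθ.2
  have e : 2 * liouvillePotential α β θ + θ * liouvillePotentialDeriv α β θ =
      (1 / 4 - α ^ 2) * ((2 * (1 - Real.cos θ) - θ * Real.sin θ) / (2 * (1 - Real.cos θ) ^ 2)) +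
      (1 / 4 - β ^ 2) * ((2 * (1 + Real.cos θ) + θ * Real.sin θ) / (2 * (1 + Real.cos θ) ^ 2)) := by
    rw [liouvillePotential, liouvillePotentialDeriv]
    field_simp
    ring
  rw [e]
  refine (abs_add_le _ _).trans (add_le_add ?_ ?_)
  · rw [abs_mul]
    refine mul_le_mul_of_nonneg_left ?_ (abs_nonneg _)
    rw [abs_div, abs_of_pos (by positivity : 0 < 2 * (1 - Real.cos θ) ^ 2),
      div_le_iff₀ (by positivity)]
    have hθ0 := hθ.1
    have g3 : (θ ^ 2 / 5) ^ 2 ≤ (1 - Real.cos θ) ^ 2 := pow_le_pow_left₀ (by positivity) g1 2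
    nlinarith [abs_two_mul_one_sub_cos_sub_le hθ.1, pow_pos hθ.1 4]
  · rw [abs_mul]
    refine mul_le_mul_of_nonneg_left ?_ (abs_nonneg _)
    rw [abs_div, abs_of_pos (by positivity : 0 < 2 * (1 + Real.cos θ) ^ 2),
      div_le_iff₀ (by positivity)]
    have hs := abs_le.1 (Real.abs_sin_le_one θ)
    have hc := Real.cos_le_one θ
    have g3 : (1 / 20) ^ 2 ≤ (1 + Real.cos θ) ^ 2 := pow_le_pow_left₀ (by positivity) g2 2
    have b1 : |2 * (1 + Real.cos θ) + θ * Real.sin θ| ≤ 13 / 2 := by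
      rw [abs_le]
      constructor <;> nlinarith [hθ.1, hθ.2]
    nlinarith

theorem liouvilleAmp_sq (α β θ : ℝ) :
    liouvilleAmp α β θ ^ 2 =
      (1 - Real.cos θ) ^ (α + 1 / 2) * (1 + Real.cos θ) ^ (β + 1 / 2) := by
  have p1 : 0 ≤ 1 - Real.cos θ := by linarith [Real.cos_le_one θ]
  have p2 : 0 ≤ 1 + Real.cos θ := by linarith [Real.neg_one_le_cos θ]
  rw [liouvilleAmp, mul_pow, ← Real.rpow_mul_natCast p1, ← Real.rpow_mul_natCast p2]
  norm_num

theorem tendsto_liouvilleAmp_sq_mul {α : ℝ} (hα : -1 < α) (β : ℝ) :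
    Tendsto (fun θ => liouvilleAmp α β θ ^ 2 * θ) (𝓝[>] 0) (𝓝 0) := by
  have hlim : Tendsto (fun θ : ℝ => 3 * ((1 - Real.cos θ) ^ (α + 1) *
      (1 + Real.cos θ) ^ (β + 1 / 2))) (𝓝[>] 0) (𝓝 0) := by
    have hc : ContinuousAt (fun θ : ℝ => 3 * ((1 - Real.cos θ) ^ (α + 1) *
        (1 + Real.cos θ) ^ (β + 1 / 2))) 0 := by
      refine continuousAt_const.mul (ContinuousAt.mul ?_ ?_)
      · exact ContinuousAt.rpow_const (by fun_prop) (Or.inr (by linarith))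
      · exact ContinuousAt.rpow_const (by fun_prop) (Or.inl (by norm_num [Real.cos_zero]))
    have h0 : 3 * ((1 - Real.cos 0) ^ (α + 1) * (1 + Real.cos 0) ^ (β + 1 / 2)) = 0 := by
      have : α + 1 ≠ 0 := by linarith
      simp [Real.zero_rpow this]
    have h := hc.tendsto.mono_left (nhdsWithin_le_nhds (s := Set.Ioi 0))
    rwa [h0] at h
  refine squeeze_zero' ?_ ?_ hlim
  · filter_upwards [self_mem_nhdsWithin] with θ hθ
    exact mul_nonneg (sq_nonneg _) (le_of_lt hθ)
  · filter_upwards [Ioo_mem_nhdsGT Real.pi_pos] with θ hθ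
    have p1 := one_sub_cos_pos hθ
    have p2 := one_add_cos_pos hθ
    rw [liouvilleAmp_sq]
    have hsq : θ ≤ 3 * (1 - Real.cos θ) ^ (1 / 2 : ℝ) := by
      rw [← Real.sqrt_eq_rpow]
      have := one_sub_cos_ge (θ := θ) (by rw [abs_of_pos hθ.1]; exact hθ.2.le)
      have h9 : θ / 3 ≤ √(1 - Real.cos θ) := Real.le_sqrt_of_sq_le (by nlinarith [sq_nonneg θ])
      linarith
    have e : (1 - Real.cos θ) ^ (α + 1) = (1 - Real.cos θ) ^ (α + 1 / 2) *
        (1 - Real.cos θ) ^ (1 / 2 : ℝ) := by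
      rw [← Real.rpow_add p1]; norm_num [add_assoc]
    rw [e]
    have := mul_le_mul_of_nonneg_left hsq (by positivity :
      0 ≤ (1 - Real.cos θ) ^ (α + 1 / 2) * (1 + Real.cos θ) ^ (β + 1 / 2))
    linarith

theorem exists_eval_cos_bound (P : ℝ[X]) : ∃ M : ℝ, 0 ≤ M ∧ ∀ θ : ℝ, |P.eval (Real.cos θ)| ≤ M := by
  obtain ⟨M, hM⟩ := isCompact_Icc.exists_bound_of_continuousOn
    (s := Set.Icc (-1 : ℝ) 1) (P.continuous.continuousOn)
  exact ⟨|M|, abs_nonneg _, fun θ =>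
    (hM _ ⟨Real.neg_one_le_cos θ, Real.cos_le_one θ⟩).trans (le_abs_self M)⟩

/-- For α < 0 the terms θE and uu' generally diverge separately, like θ^(2α). In the difference the
singular parts combine into (θ - sin θ)/(1 - cos θ) = O(θ), so the virial is O(A²θ) for the
amplitude A, and A²θ → 0 because α > -1. -/
theorem tendsto_liouvilleVirial_zero {α β ρ l : ℝ} (hα : -1 < α) (P : ℝ[X])
    (hρ : ρ ^ 2 = l + ((α + β + 1) / 2) ^ 2) :
    Tendsto (liouvilleVirial α β ρ P) (𝓝[>] 0) (𝓝 0) := by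
  obtain ⟨M₀, hM₀, hP₀⟩ := exists_eval_cos_bound P
  obtain ⟨M₁, hM₁, hP₁⟩ := exists_eval_cos_bound (derivative P)
  set K₁ := |l| + |α + 1 / 2| + |β + 1 / 2|
  set K₂ := 1 + 5 * |α + 1 / 2| + |β + 1 / 2|
  have hlim := (tendsto_liouvilleAmp_sq_mul hα β).const_mul
    (K₁ * M₀ ^ 2 + K₂ * (M₀ * M₁) + M₁ ^ 2)
  rw [mul_zero] at hlim
  refine squeeze_zero_norm' ?_ hlim
  filter_upwards [Ioo_mem_nhdsGT one_pos] with θ hθ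
  have hθ' : θ ∈ Set.Ioo 0 Real.pi := ⟨hθ.1, by linarith [hθ.2, Real.pi_gt_three]⟩
  have p1 := one_sub_cos_pos hθ'
  have p2 : 1 ≤ 1 + Real.cos θ := by
    have := Real.cos_pos_of_le_one (by rw [abs_of_pos hθ.1]; exact hθ.2.le)
    linarith
  have hq := liouvilleLogDeriv_sq_add_potential α β hθ'
  have g := one_sub_cos_ge (θ := θ) (by rw [abs_of_pos hθ.1]; exact hθ'.2.le)
  have hs1 := Real.sin_lt hθ.1
  have hs2 := Real.sin_gt_sub_cube hθ.1
  have hs0 := Real.sin_pos_of_pos_of_lt_pi hθ.1 hθ'.2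
  set w := liouvilleLogDeriv α β θ with hw
  set A := liouvilleAmp α β θ
  set c := Real.cos θ with hc
  set S := Real.sin θ with hS
  set P0 := eval c P
  set P1 := eval c (derivative P)
  have e : liouvilleVirial α β ρ P θ = A ^ 2 *
      ((l * θ + (α + 1 / 2) / 2 * ((θ - S) / (1 - c)) + (β + 1 / 2) / 2 * ((θ + S) / (1 + c)))
        * P0 ^ 2 + (1 - 2 * (θ * w)) * S * (P0 * P1) + θ * S ^ 2 * P1 ^ 2) := by
    have e0 : liouvilleVirial α β ρ P θ = A ^ 2 * ((θ * (w ^ 2 + liouvillePotential α β θ + ρ ^ 2)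
        - w) * P0 ^ 2 + (1 - 2 * (θ * w)) * S * (P0 * P1) + θ * S ^ 2 * P1 ^ 2) := by
      rw [liouvilleVirial, liouvilleEnergy, liouvilleDeriv, liouville]
      ring
    rw [e0, hq, hρ, hw, liouvilleLogDeriv]
    ring
  have b1 : |(θ - S) / (1 - c)| ≤ 2 * θ := by
    rw [abs_div, abs_of_pos p1, abs_of_pos (by linarith), div_le_iff₀ p1]
    have := mul_le_mul_of_nonneg_left g hθ.1.le
    have h3 := pow_pos hθ.1 3
    have e3 : θ * (θ ^ 2 / 5) = θ ^ 3 / 5 := by ring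
    linarith
  have b2 : |(θ + S) / (1 + c)| ≤ 2 * θ := by
    rw [abs_div, abs_of_pos (by linarith : 0 < 1 + c), abs_of_pos (by linarith [hθ.1]),
      div_le_iff₀ (by linarith)]
    have := mul_le_mul_of_nonneg_left p2 hθ.1.le
    linarith
  have b3 : |1 - 2 * (θ * w)| ≤ K₂ := by
    have e3 : 1 - 2 * (θ * w) = 1 - (α + 1 / 2) * (θ * S / (1 - c)) +
        (β + 1 / 2) * (θ * S / (1 + c)) := by
      rw [hw, liouvilleLogDeriv]; ring
    have h1 : |θ * S / (1 - c)| ≤ 5 := by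
      rw [abs_div, abs_of_pos p1, abs_of_pos (mul_pos hθ.1 hs0), div_le_iff₀ p1]
      have := mul_le_mul_of_nonneg_left hs1.le hθ.1.le
      linarith [sq θ]
    have h2 : |θ * S / (1 + c)| ≤ 1 := by
      rw [abs_div, abs_of_pos (by linarith : 0 < 1 + c), abs_of_pos (mul_pos hθ.1 hs0),
        div_le_iff₀ (by linarith)]
      have := mul_le_one₀ hθ.2.le hs0.le (hs1.le.trans hθ.2.le)
      linarith
    rw [e3]
    refine (abs_add_le _ _).trans (add_le_add ((abs_sub _ _).trans (add_le_add (by simp) ?_)) ?_)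
    · rw [abs_mul, mul_comm]; gcongr
    · rw [abs_mul]
      simpa using mul_le_mul_of_nonneg_left h2 (abs_nonneg (β + 1 / 2))
  have b0 : |l * θ + (α + 1 / 2) / 2 * ((θ - S) / (1 - c)) +
      (β + 1 / 2) / 2 * ((θ + S) / (1 + c))| ≤ K₁ * θ := by
    refine (abs_add_three _ _ _).trans ?_
    rw [abs_mul, abs_mul, abs_mul, abs_of_pos hθ.1, abs_div, abs_div (β + 1 / 2), abs_two]
    have h1 := mul_le_mul_of_nonneg_left b1 (by positivity : 0 ≤ |α + 1 / 2| / 2)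
    have h2 := mul_le_mul_of_nonneg_left b2 (by positivity : 0 ≤ |β + 1 / 2| / 2)
    simp only [K₁]
    linarith
  rw [e, Real.norm_eq_abs, abs_mul, abs_of_nonneg (sq_nonneg A)]
  have hb : |(l * θ + (α + 1 / 2) / 2 * ((θ - S) / (1 - c)) + (β + 1 / 2) / 2 * ((θ + S) / (1 + c)))
        * P0 ^ 2 + (1 - 2 * (θ * w)) * S * (P0 * P1) + θ * S ^ 2 * P1 ^ 2| ≤
      (K₁ * M₀ ^ 2 + K₂ * (M₀ * M₁) + M₁ ^ 2) * θ := by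
    refine (abs_add_three _ _ _).trans ?_
    have k0 := hP₀ θ
    have k1 := hP₁ θ
    have t1 : |(l * θ + (α + 1 / 2) / 2 * ((θ - S) / (1 - c)) +
        (β + 1 / 2) / 2 * ((θ + S) / (1 + c))) * P0 ^ 2| ≤ K₁ * θ * M₀ ^ 2 := by
      rw [abs_mul, abs_pow]
      exact mul_le_mul b0 (pow_le_pow_left₀ (abs_nonneg _) k0 2) (by positivity)
        ((abs_nonneg _).trans b0)
    have t2 : |(1 - 2 * (θ * w)) * S * (P0 * P1)| ≤ K₂ * θ * (M₀ * M₁) := by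
      rw [abs_mul, abs_mul, abs_mul P0, abs_of_pos hs0]
      exact mul_le_mul (mul_le_mul b3 hs1.le hs0.le (by positivity))
        (mul_le_mul k0 k1 (abs_nonneg _) hM₀) (by positivity) (by have := hθ.1.le; positivity)
    have t3 : |θ * S ^ 2 * P1 ^ 2| ≤ θ * M₁ ^ 2 := by
      rw [abs_mul, abs_mul, abs_pow P1, abs_of_pos hθ.1, abs_of_nonneg (sq_nonneg S)]
      refine mul_le_mul ?_ (pow_le_pow_left₀ (abs_nonneg _) k1 2) (by positivity) hθ.1.le
      exact mul_le_of_le_one_right hθ.1.le (Real.sin_sq_le_one θ)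
    linarith
  calc A ^ 2 * _ ≤ A ^ 2 * ((K₁ * M₀ ^ 2 + K₂ * (M₀ * M₁) + M₁ ^ 2) * θ) :=
        mul_le_mul_of_nonneg_left hb (sq_nonneg A)
    _ = _ := by ring

/-- The Jacobian sin θ supplies the extra 1/2 in the exponents of the squared amplitude, so the
transform preserves the L² norm. -/
theorem sin_mul_jacobiWeight_cos (α β : ℝ) (P : ℝ[X]) {θ : ℝ} (h : θ ∈ Set.Ioo 0 Real.pi) :
    |(-Real.sin θ)| • ((P * P).eval (Real.cos θ) * jacobiWeight α β (Real.cos θ)) =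
      liouville α β P θ ^ 2 := by
  have p1 := one_sub_cos_pos h
  have p2 := one_add_cos_pos h
  have hs0 := Real.sin_pos_of_pos_of_lt_pi h.1 h.2
  have hs : Real.sin θ = (1 - Real.cos θ) ^ (1 / 2 : ℝ) * (1 + Real.cos θ) ^ (1 / 2 : ℝ) := by
    rw [← Real.mul_rpow p1.le p2.le, ← Real.sqrt_eq_rpow,
      show (1 - Real.cos θ) * (1 + Real.cos θ) = Real.sin θ ^ 2 by
        nlinarith [Real.sin_sq_add_cos_sq θ], Real.sqrt_sq hs0.le]
  rw [abs_neg, abs_of_pos hs0, smul_eq_mul, liouville, mul_pow,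
    liouvilleAmp_sq, Real.rpow_add p1, Real.rpow_add p2, jacobiWeight,
    eval_mul, hs]
  ring

theorem image_cos_Ioo : Real.cos '' Set.Ioo 0 Real.pi = Set.Ioo (-1) 1 := by
  ext x
  constructor
  · rintro ⟨θ, hθ, rfl⟩
    exact ⟨by linarith [one_add_cos_pos hθ], by linarith [one_sub_cos_pos hθ]⟩
  · intro hx
    exact ⟨Real.arccos x, ⟨Real.arccos_pos.2 hx.2, Real.arccos_lt_pi.2 hx.1⟩,
      Real.cos_arccos hx.1.le hx.2.le⟩

theorem integrableOn_liouville_sq {α β : ℝ} (hα : -1 < α) (hβ : -1 < β) (P : ℝ[X]) :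
    IntegrableOn (fun θ => liouville α β P θ ^ 2) (Set.Ioo 0 Real.pi) ∧
      ∫ θ in Set.Ioo 0 Real.pi, liouville α β P θ ^ 2 = jacobiFunctional hα hβ (P * P) := by
  have hd : ∀ x ∈ Set.Ioo 0 Real.pi,
      HasDerivWithinAt Real.cos (-Real.sin x) (Set.Ioo 0 Real.pi) x :=
    fun x _ => (Real.hasDerivAt_cos x).hasDerivWithinAt
  have hinj : Set.InjOn Real.cos (Set.Ioo 0 Real.pi) :=
    Real.injOn_cos.mono Set.Ioo_subset_Icc_self
  have hint := intervalIntegrable_eval_mul_jacobiWeight hα hβ (P * P)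
  rw [intervalIntegrable_iff_integrableOn_Ioo_of_le (by norm_num)] at hint
  constructor
  · rw [← image_cos_Ioo, integrableOn_image_iff_integrableOn_abs_deriv_smul measurableSet_Ioo
      hd hinj] at hint
    exact hint.congr_fun (fun θ hθ => sin_mul_jacobiWeight_cos α β P hθ) measurableSet_Ioo
  · change _ = ∫ x in (-1 : ℝ)..1, (P * P).eval x * jacobiWeight α β x
    rw [intervalIntegral.integral_of_le (by norm_num), integral_Ioc_eq_integral_Ioo,
      ← image_cos_Ioo, integral_image_eq_integral_abs_deriv_smul measurableSet_Ioo hd hinj]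
    exact (setIntegral_congr_fun measurableSet_Ioo
      fun θ hθ => sin_mul_jacobiWeight_cos α β P hθ).symm

theorem intervalIntegrable_liouville_sq {α β : ℝ} (hα : -1 < α) (hβ : -1 < β) (P : ℝ[X])
    {s t : ℝ} (hs : s ∈ Set.Icc 0 Real.pi) (ht : t ∈ Set.Icc 0 Real.pi) :
    IntervalIntegrable (fun θ => liouville α β P θ ^ 2) volume s t := by
  have h : IntervalIntegrable (fun θ => liouville α β P θ ^ 2) volume 0 Real.pi := by
    rw [intervalIntegrable_iff_integrableOn_Ioo_of_le Real.pi_pos.le]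
    exact (integrableOn_liouville_sq hα hβ P).1
  refine h.mono_set ?_
  rw [Set.uIcc_of_le Real.pi_pos.le]
  exact Set.uIcc_subset_Icc hs ht

/-- Integrated virial identity. It matters that M depends on α and β only, not on the solution or
its eigenvalue. -/
theorem exists_liouvilleVirial_bound {α β : ℝ} (hα : -1 < α) (hβ : -1 < β) :
    ∃ M : ℝ, 0 ≤ M ∧ ∀ (P : ℝ[X]) (l ρ : ℝ), jacobiOperator α β P + C l * P = 0 →
      ρ ^ 2 = l + ((α + β + 1) / 2) ^ 2 → ∀ t ∈ Set.Ioc (0 : ℝ) (5 / 2),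
      |liouvilleVirial α β ρ P t - 2 * ρ ^ 2 * ∫ θ in (0 : ℝ)..t, liouville α β P θ ^ 2| ≤
        M * ∫ θ in (0 : ℝ)..t, liouville α β P θ ^ 2 := by
  obtain ⟨M, hM, hb⟩ := exists_potential_virial_bound α β
  refine ⟨M, hM, fun P l ρ hode hρ t ht => ?_⟩
  have hp := Real.pi_gt_d2
  have htp : t ∈ Set.Ioo 0 Real.pi := ⟨ht.1, by linarith [ht.2]⟩
  have hu := intervalIntegrable_liouville_sq hα hβ P (s := 0) (t := t)
    ⟨le_rfl, Real.pi_pos.le⟩ ⟨htp.1.le, htp.2.le⟩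
  set k : ℝ → ℝ := fun θ => 2 * liouvillePotential α β θ + θ * liouvillePotentialDeriv α β θ
  have hku : IntervalIntegrable (fun θ => k θ * liouville α β P θ ^ 2) volume 0 t := by
    rw [intervalIntegrable_iff_integrableOn_Ioc_of_le ht.1.le] at hu ⊢
    refine Integrable.bdd_mul (c := M) hu ?_ ?_
    · refine Measurable.aestronglyMeasurable ?_
      simp only [k]
      unfold liouvillePotential liouvillePotentialDeriv
      fun_prop
    · refine (ae_restrict_iff' measurableSet_Ioc).2 (Eventually.of_forall fun θ hθ => ?_)
      exact hb θ ⟨hθ.1, hθ.2.trans ht.2⟩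
  have hftc := intervalIntegral.integral_eq_sub_of_hasDerivAt_of_tendsto ht.1
    (fun θ hθ => hasDerivAt_liouvilleVirial hode hρ (θ := θ) ⟨hθ.1, hθ.2.trans htp.2⟩)
    ((hu.const_mul (2 * ρ ^ 2)).add hku) (tendsto_liouvilleVirial_zero hα P hρ)
    ((hasDerivAt_liouvilleVirial hode hρ htp).continuousAt.tendsto.mono_left nhdsWithin_le_nhds)
  rw [intervalIntegral.integral_add (hu.const_mul (2 * ρ ^ 2)) hku,
    intervalIntegral.integral_const_mul, sub_zero] at hftc
  rw [← hftc, add_sub_cancel_left, ← intervalIntegral.integral_const_mul, ← Real.norm_eq_abs]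
  refine intervalIntegral.norm_integral_le_of_norm_le ht.1.le ?_ (hu.const_mul M)
  refine Eventually.of_forall fun θ hθ => ?_
  rw [norm_mul, Real.norm_eq_abs, Real.norm_eq_abs, abs_of_nonneg (sq_nonneg (liouville α β P θ))]
  exact mul_le_mul_of_nonneg_right (hb θ ⟨hθ.1, hθ.2.trans ht.2⟩) (sq_nonneg _)

/-! ### Reflection and the energy in the interior -/

section
variable (α β : ℝ) (P : ℝ[X]) (θ : ℝ)

theorem liouvilleAmp_pi_sub : liouvilleAmp β α (Real.pi - θ) = liouvilleAmp α β θ := by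
  simp only [liouvilleAmp, Real.cos_pi_sub, sub_neg_eq_add, ← sub_eq_add_neg]
  ring

theorem liouvilleLogDeriv_pi_sub :
    liouvilleLogDeriv β α (Real.pi - θ) = -liouvilleLogDeriv α β θ := by
  simp only [liouvilleLogDeriv, Real.cos_pi_sub, Real.sin_pi_sub, sub_neg_eq_add, ← sub_eq_add_neg]
  ring

theorem liouvillePotential_pi_sub :
    liouvillePotential β α (Real.pi - θ) = liouvillePotential α β θ := by
  simp only [liouvillePotential, Real.cos_pi_sub, sub_neg_eq_add, ← sub_eq_add_neg]
  ring

theorem liouville_comp_neg_X :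
    liouville β α (P.comp (-X)) (Real.pi - θ) = liouville α β P θ := by
  rw [liouville, liouville, liouvilleAmp_pi_sub, Real.cos_pi_sub]
  simp

theorem liouvilleDeriv_comp_neg_X :
    liouvilleDeriv β α (P.comp (-X)) (Real.pi - θ) = -liouvilleDeriv α β P θ := by
  rw [liouvilleDeriv, liouvilleDeriv, liouvilleAmp_pi_sub, liouvilleLogDeriv_pi_sub,
    Real.cos_pi_sub, Real.sin_pi_sub, derivative_comp]
  simp only [eval_comp, eval_neg, eval_X, neg_neg, derivative_neg, derivative_X, eval_mul, eval_one]
  ring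

/-- The reflection keeps the energy and reverses the sign of uu', so the virials from the two
endpoints add up to πE. -/
theorem liouvilleVirial_comp_neg_X (ρ : ℝ) :
    liouvilleVirial β α ρ (P.comp (-X)) (Real.pi - θ) =
      (Real.pi - θ) * liouvilleEnergy α β ρ P θ + liouville α β P θ * liouvilleDeriv α β P θ := by
  rw [liouvilleVirial, liouvilleEnergy, liouvilleEnergy, liouvilleDeriv_comp_neg_X,
    liouville_comp_neg_X, liouvillePotential_pi_sub]
  ring

theorem integral_liouville_comp_neg_X_sq :
    ∫ φ in (0 : ℝ)..(Real.pi - θ), liouville β α (P.comp (-X)) φ ^ 2 =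
      ∫ φ in θ..Real.pi, liouville α β P φ ^ 2 := by
  have h := intervalIntegral.integral_comp_sub_left (a := θ) (b := Real.pi)
    (fun φ => liouville β α (P.comp (-X)) φ ^ 2) Real.pi
  simp only [liouville_comp_neg_X, sub_self] at h
  exact h.symm

end

theorem jacobiOperator_comp_neg_X {α β l : ℝ} {P : ℝ[X]}
    (h : jacobiOperator α β P + C l * P = 0) :
    jacobiOperator β α (P.comp (-X)) + C l * P.comp (-X) = 0 := by
  have e : jacobiOperator β α (P.comp (-X)) + C l * P.comp (-X) =
      (jacobiOperator α β P + C l * P).comp (-X) := by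
    simp only [jacobiOperator, derivative_comp, derivative_mul, derivative_neg, derivative_X,
      add_comp, mul_comp, sub_comp, C_comp, X_comp, pow_comp, one_comp, derivative_one, C_add, C_sub]
    ring
  rw [e, h, zero_comp]

theorem exists_liouvilleEnergy_bound {α β : ℝ} (hα : -1 < α) (hβ : -1 < β) :
    ∃ M : ℝ, 0 ≤ M ∧ ∀ (P : ℝ[X]) (l ρ : ℝ), jacobiOperator α β P + C l * P = 0 →
      ρ ^ 2 = l + ((α + β + 1) / 2) ^ 2 → ∀ t ∈ Set.Icc (1 : ℝ) 2,
      |Real.pi * liouvilleEnergy α β ρ P t - 2 * ρ ^ 2 * jacobiFunctional hα hβ (P * P)| ≤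
        M * jacobiFunctional hα hβ (P * P) := by
  obtain ⟨M₁, hM₁, h₁⟩ := exists_liouvilleVirial_bound hα hβ
  obtain ⟨M₂, hM₂, h₂⟩ := exists_liouvilleVirial_bound hβ hα
  refine ⟨M₁ + M₂, by positivity, fun P l ρ hode hρ t ht => ?_⟩
  have hp := Real.pi_gt_d2
  have hp' := Real.pi_lt_d2
  have htp : t ∈ Set.Icc 0 Real.pi := ⟨by linarith [ht.1], by linarith [ht.2]⟩
  have k₁ := h₁ P l ρ hode hρ t ⟨by linarith [ht.1], by linarith [ht.2]⟩
  have k₂ := h₂ (P.comp (-X)) l ρ (jacobiOperator_comp_neg_X hode) (by rw [hρ]; ring)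
    (Real.pi - t) ⟨by linarith [ht.2], by linarith [ht.1]⟩
  rw [liouvilleVirial_comp_neg_X, integral_liouville_comp_neg_X_sq] at k₂
  have i₁ := intervalIntegrable_liouville_sq hα hβ P (Set.left_mem_Icc.2 Real.pi_pos.le) htp
  have i₂ := intervalIntegrable_liouville_sq hα hβ P htp (Set.right_mem_Icc.2 Real.pi_pos.le)
  have hadd := intervalIntegral.integral_add_adjacent_intervals i₁ i₂
  rw [intervalIntegral.integral_of_le (a := (0 : ℝ)) (b := Real.pi) Real.pi_pos.le,
    integral_Ioc_eq_integral_Ioo, (integrableOn_liouville_sq hα hβ P).2] at hadd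
  have n₁ : 0 ≤ ∫ θ in (0 : ℝ)..t, liouville α β P θ ^ 2 :=
    intervalIntegral.integral_nonneg htp.1 fun _ _ => sq_nonneg _
  have n₂ : 0 ≤ ∫ θ in t..Real.pi, liouville α β P θ ^ 2 :=
    intervalIntegral.integral_nonneg htp.2 fun _ _ => sq_nonneg _
  rw [← hadd]
  rw [liouvilleVirial] at k₁
  set E := liouvilleEnergy α β ρ P t
  set I₁ := ∫ θ in (0 : ℝ)..t, liouville α β P θ ^ 2
  set I₂ := ∫ θ in t..Real.pi, liouville α β P θ ^ 2
  have k := (abs_add_le _ _).trans (add_le_add k₁ k₂)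
  have e : Real.pi * E - 2 * ρ ^ 2 * (I₁ + I₂) =
      t * E - liouville α β P t * liouvilleDeriv α β P t - 2 * ρ ^ 2 * I₁ +
      ((Real.pi - t) * E + liouville α β P t * liouvilleDeriv α β P t - 2 * ρ ^ 2 * I₂) := by ring
  rw [e]
  refine k.trans ?_
  have := mul_nonneg hM₁ n₂
  have := mul_nonneg hM₂ n₁
  linarith

theorem exists_liouvillePotential_bound (α β : ℝ) : ∃ A : ℝ, 0 ≤ A ∧ ∀ θ ∈ Set.Icc (1 : ℝ) 2,
    |liouvillePotential α β θ| ≤ A ∧ |liouvillePotentialDeriv α β θ| ≤ A := by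
  have hI : ∀ θ ∈ Set.Icc (1 : ℝ) 2, θ ∈ Set.Ioo 0 Real.pi := fun θ hθ =>
    ⟨by linarith [hθ.1], by linarith [hθ.2, Real.pi_gt_three]⟩
  obtain ⟨A₁, h₁⟩ := isCompact_Icc.exists_bound_of_continuousOn (s := Set.Icc (1 : ℝ) 2)
    (f := liouvillePotential α β)
    fun θ hθ => (hasDerivAt_liouvillePotential α β (hI θ hθ)).continuousAt.continuousWithinAt
  obtain ⟨A₂, h₂⟩ := isCompact_Icc.exists_bound_of_continuousOn (s := Set.Icc (1 : ℝ) 2)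
    (f := liouvillePotentialDeriv α β) (by
      unfold liouvillePotentialDeriv
      intro θ hθ
      have p1 := one_sub_cos_pos (hI θ hθ)
      have p2 := one_add_cos_pos (hI θ hθ)
      refine ContinuousAt.continuousWithinAt ?_
      fun_prop (disch := positivity))
  refine ⟨max |A₁| |A₂|, by positivity, fun θ hθ => ⟨?_, ?_⟩⟩
  · exact ((h₁ θ hθ).trans (le_abs_self _)).trans (le_max_left _ _)
  · exact ((h₂ θ hθ).trans (le_abs_self _)).trans (le_max_right _ _)

/-! ### Sine asymptotics of the Wronskian and of the kernel -/

/-- Sine asymptotics for the Wronskian-type form `u(s) u'(t) - u(t) u'(s)`, with the a priori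
bounds for `u` and `u'`. -/
theorem exists_liouville_wronskian_bound {α β : ℝ} (hα : -1 < α) (hβ : -1 < β) :
    ∃ M : ℝ, 1 ≤ M ∧ ∀ (P : ℝ[X]) (l ρ : ℝ), jacobiOperator α β P + C l * P = 0 →
      ρ ^ 2 = l + ((α + β + 1) / 2) ^ 2 → M ≤ ρ → 0 ≤ jacobiFunctional hα hβ (P * P) →
      (∀ t ∈ Set.Icc (1 : ℝ) 2,
        |liouville α β P t| ≤ 2 * √(jacobiFunctional hα hβ (P * P)) ∧
        |liouvilleDeriv α β P t| ≤ ρ * √(jacobiFunctional hα hβ (P * P))) ∧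
      ∀ s ∈ Set.Icc (1 : ℝ) 2, ∀ t ∈ Set.Icc (1 : ℝ) 2,
        |liouville α β P s * liouvilleDeriv α β P t - liouville α β P t * liouvilleDeriv α β P s -
          2 * ρ / Real.pi * Real.sin (ρ * (s - t)) * jacobiFunctional hα hβ (P * P)| ≤
          M * jacobiFunctional hα hβ (P * P) * |s - t| := by
  obtain ⟨A, hA, hq⟩ := exists_liouvillePotential_bound α β
  obtain ⟨B, hB, hE⟩ := exists_liouvilleEnergy_bound hα hβ
  refine ⟨8 * A + B + 1, by linarith, fun P l ρ hode hρ hM hh => ?_⟩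
  set h := jacobiFunctional hα hβ (P * P)
  set u := liouville α β P
  set v := liouvilleDeriv α β P
  set q := liouvillePotential α β
  set q' := liouvillePotentialDeriv α β
  have hp := Real.pi_gt_three
  have hρ1 : 1 ≤ ρ := by linarith
  have hρ0 : 0 < ρ := by linarith
  have hρρ : ρ ≤ ρ ^ 2 := by nlinarith
  have hI : ∀ θ ∈ Set.Icc (1 : ℝ) 2, θ ∈ Set.Ioo 0 Real.pi := fun θ hθ =>
    ⟨by linarith [hθ.1], by linarith [hθ.2]⟩
  -- πE ≤ (2ρ² + B)h ≤ 3ρ²h, and π > 3.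
  have hEle : ∀ t ∈ Set.Icc (1 : ℝ) 2, v t ^ 2 + (ρ ^ 2 + q t) * u t ^ 2 ≤ ρ ^ 2 * h := by
    intro t ht
    have k := (abs_le.1 (hE P l ρ hode hρ t ht)).2
    change Real.pi * (v t ^ 2 + (ρ ^ 2 + q t) * u t ^ 2) - 2 * ρ ^ 2 * h ≤ B * h at k
    have hBh : B * h ≤ ρ ^ 2 * h := mul_le_mul_of_nonneg_right (by linarith) hh
    by_contra hcon
    push Not at hcon
    have : 0 ≤ ρ ^ 2 * h := by positivity
    nlinarith
  have hlow : ∀ t ∈ Set.Icc (1 : ℝ) 2, ρ ^ 2 / 2 ≤ ρ ^ 2 + q t := by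
    intro t ht
    have := (abs_le.1 (hq t ht).1).1
    linarith
  have hbound : ∀ t ∈ Set.Icc (1 : ℝ) 2, |u t| ≤ 2 * √h ∧ |v t| ≤ ρ * √h := by
    intro t ht
    have k1 := hEle t ht
    have k2 := mul_le_mul_of_nonneg_right (hlow t ht) (sq_nonneg (u t))
    have k3 := sq_nonneg (u t)
    have k4 : 0 ≤ ρ ^ 2 / 2 * u t ^ 2 := by positivity
    constructor
    · refine abs_le_of_sq_le_sq ?_ (by positivity)
      rw [mul_pow, Real.sq_sqrt hh]
      have : ρ ^ 2 / 2 * u t ^ 2 ≤ ρ ^ 2 / 2 * (2 * h) := by nlinarith [sq_nonneg (v t)]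
      have := le_of_mul_le_mul_left this (by positivity)
      linarith
    · refine abs_le_of_sq_le_sq ?_ (by positivity)
      rw [mul_pow, Real.sq_sqrt hh]
      linarith
  refine ⟨hbound, fun s hs t ht => ?_⟩
  have hsh : √h * √h = h := Real.mul_self_sqrt hh
  have huv : ∀ σ ∈ Set.Icc (1 : ℝ) 2, ∀ τ ∈ Set.Icc (1 : ℝ) 2, |u σ * v τ| ≤ 2 * ρ * h := by
    intro σ hσ τ hτ
    rw [abs_mul]
    refine (mul_le_mul (hbound σ hσ).1 (hbound τ hτ).2 (abs_nonneg _) (by positivity)).trans ?_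
    exact le_of_eq (by linear_combination (2 * ρ) * hsh)
  have huu : ∀ σ ∈ Set.Icc (1 : ℝ) 2, ∀ τ ∈ Set.Icc (1 : ℝ) 2, |u σ * u τ| ≤ 4 * h := by
    intro σ hσ τ hτ
    rw [abs_mul]
    refine (mul_le_mul (hbound σ hσ).1 (hbound τ hτ).1 (abs_nonneg _) (by positivity)).trans ?_
    exact le_of_eq (by linear_combination 4 * hsh)
  set d : ℝ → ℝ := fun σ => u σ * v t - u t * v σ with hd
  -- Variation of parameters: m = d' sin(ρ(s-σ)) + ρ d cos(ρ(s-σ)), so m' = (d'' + ρ²d) sin(ρ(s-σ))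
  -- contains only q and q'. Its end values are m(s) = ρ d(s) and m(t) = E(t) sin(ρ(s-t)); the mean
  -- value inequality compares them with an error proportional to |s-t|.
  set m : ℝ → ℝ := fun σ => (v σ * v t + u t * ((ρ ^ 2 + q σ) * u σ)) * Real.sin (ρ * (s - σ)) +
    ρ * d σ * Real.cos (ρ * (s - σ)) with hm
  have hm' : ∀ σ ∈ Set.Icc (1 : ℝ) 2, HasDerivWithinAt m
      ((q' σ * (u t * u σ) - q σ * d σ) * Real.sin (ρ * (s - σ))) (Set.Icc 1 2) σ := by
    intro σ hσ
    have du := hasDerivAt_liouville α β P (hI σ hσ)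
    have dv := hasDerivAt_liouvilleDeriv hode hρ (hI σ hσ)
    have dq := hasDerivAt_liouvillePotential α β (hI σ hσ)
    have dl : HasDerivAt (fun σ : ℝ => ρ * (s - σ)) (-ρ) σ := by
      simpa using ((hasDerivAt_id σ).const_sub s).const_mul ρ
    have dd : HasDerivAt d (v σ * v t + u t * ((ρ ^ 2 + q σ) * u σ)) σ := by
      refine ((du.mul_const (v t)).sub (dv.const_mul (u t))).congr_deriv ?_
      simp only [u, v, q]
      ring
    have dmain := (((dv.mul_const (v t)).add (((dq.const_add (ρ ^ 2)).mul du).const_mul (u t))).mul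
      dl.sin).add ((dd.const_mul ρ).mul dl.cos)
    refine (dmain.congr_deriv ?_).hasDerivWithinAt
    simp only [Pi.add_apply, Pi.mul_apply, hd, u, v, q, q']
    ring
  have hbd : ∀ σ ∈ Set.Icc (1 : ℝ) 2,
      ‖(q' σ * (u t * u σ) - q σ * d σ) * Real.sin (ρ * (s - σ))‖ ≤ 8 * A * ρ * h := by
    intro σ hσ
    have hdσ : |d σ| ≤ 4 * ρ * h := by
      refine (abs_sub _ _).trans ?_
      linarith [huv σ hσ t ht, huv t ht σ hσ]
    have h1 : |q' σ * (u t * u σ)| ≤ A * (4 * h) := by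
      rw [abs_mul]
      exact mul_le_mul (hq σ hσ).2 (huu t ht σ hσ) (abs_nonneg _) hA
    have h2 : |q σ * d σ| ≤ A * (4 * ρ * h) := by
      rw [abs_mul]
      exact mul_le_mul (hq σ hσ).1 hdσ (abs_nonneg _) hA
    rw [Real.norm_eq_abs, abs_mul]
    refine (mul_le_of_le_one_right (abs_nonneg _) (Real.abs_sin_le_one _)).trans ?_
    refine (abs_sub _ _).trans ?_
    have h3 : A * (4 * h) * 1 ≤ A * (4 * h) * ρ := mul_le_mul_of_nonneg_left hρ1 (by positivity)
    linarith
  have hmvt := (convex_Icc (1 : ℝ) 2).norm_image_sub_le_of_norm_hasDerivWithin_le hm' hbd ht hs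
  have hms : m s = ρ * d s := by simp [hm]
  have hdt : d t = 0 := by simp only [hd]; ring
  have hmt : m t = liouvilleEnergy α β ρ P t * Real.sin (ρ * (s - t)) := by
    simp only [hm, hdt, liouvilleEnergy]
    change _ = (v t ^ 2 + (ρ ^ 2 + q t) * u t ^ 2) * _
    ring
  rw [hms, hmt, Real.norm_eq_abs, Real.norm_eq_abs] at hmvt
  set E := liouvilleEnergy α β ρ P t
  have hEt : |Real.pi * E - 2 * ρ ^ 2 * h| ≤ B * h := hE P l ρ hode hρ t ht
  have hsin : |Real.sin (ρ * (s - t))| ≤ ρ * |s - t| := by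
    refine Real.abs_sin_le_abs.trans ?_
    rw [abs_mul, abs_of_pos hρ0]
  have hsplit : ρ * (d s - 2 * ρ / Real.pi * Real.sin (ρ * (s - t)) * h) =
      (ρ * d s - E * Real.sin (ρ * (s - t))) +
      (Real.pi * E - 2 * ρ ^ 2 * h) * (Real.sin (ρ * (s - t)) / Real.pi) := by
    have := Real.pi_ne_zero
    field_simp
    ring
  have hsp : |Real.sin (ρ * (s - t)) / Real.pi| ≤ ρ * |s - t| := by
    rw [abs_div, abs_of_pos Real.pi_pos]
    exact (div_le_self (abs_nonneg _) (by linarith)).trans hsin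
  have hfin : ρ * |d s - 2 * ρ / Real.pi * Real.sin (ρ * (s - t)) * h| ≤
      ρ * ((8 * A + B) * h * |s - t|) := by
    rw [← abs_of_pos hρ0, ← abs_mul, abs_of_pos hρ0, hsplit]
    refine (abs_add_le _ _).trans ?_
    rw [abs_mul (Real.pi * E - _)]
    have := mul_le_mul hEt hsp (abs_nonneg _) (by positivity)
    linarith
  refine (le_of_mul_le_mul_left hfin hρ0).trans ?_
  have : 0 ≤ h * |s - t| := by positivity
  linarith

theorem sin_mul_liouvilleLogDeriv (α β : ℝ) {θ : ℝ} (h : θ ∈ Set.Ioo 0 Real.pi) :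
    Real.sin θ * liouvilleLogDeriv α β θ = ((α - β) + (α + β + 1) * Real.cos θ) / 2 := by
  have p1 := one_sub_cos_pos h
  have p2 := one_add_cos_pos h
  have hs : Real.sin θ ^ 2 = (1 - Real.cos θ) * (1 + Real.cos θ) := by
    nlinarith [Real.sin_sq_add_cos_sq θ]
  have : Real.sin θ * liouvilleLogDeriv α β θ = Real.sin θ ^ 2 *
      ((α + 1 / 2) / 2 / (1 - Real.cos θ) - (β + 1 / 2) / 2 / (1 + Real.cos θ)) := by
    rw [liouvilleLogDeriv]; ring
  rw [this, hs]
  field_simp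
  ring

/-- Since sin θ times the logarithmic derivative is affine in cos θ, passing from P' to u' merely
shifts N to N + (α+β+1)/2 in the last term. -/
theorem liouville_jacobiKernel_eq {α β : ℝ} (hα : -1 < α) (hβ : -1 < β) {N : ℕ} (hN : 0 < N)
    {s t : ℝ} (hs : s ∈ Set.Ioo 0 Real.pi) (ht : t ∈ Set.Ioo 0 Real.pi) :
    (2 * N + α + β + 1) * jacobiNormSq α β N * ((Real.cos s - Real.cos t) *
      (liouvilleAmp α β s * liouvilleAmp α β t * jacobiKernel α β N (Real.cos s) (Real.cos t))) =
    -Real.sin t *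
      (liouville α β (jacobiPolynomial α β N) s * liouvilleDeriv α β (jacobiPolynomial α β N) t -
      liouville α β (jacobiPolynomial α β N) t * liouvilleDeriv α β (jacobiPolynomial α β N) s) +
    (Real.sin s - Real.sin t) *
      (liouville α β (jacobiPolynomial α β N) t * liouvilleDeriv α β (jacobiPolynomial α β N) s) -
    (N + (α + β + 1) / 2) * (Real.cos s - Real.cos t) *
      (liouville α β (jacobiPolynomial α β N) s * liouville α β (jacobiPolynomial α β N) t) := by
  have hk := jacobiKernel_eq hα hβ hN (Real.cos s) (Real.cos t)
  have ws := sin_mul_liouvilleLogDeriv α β hs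
  have wt := sin_mul_liouvilleLogDeriv α β ht
  have ss : Real.sin s ^ 2 = 1 - Real.cos s ^ 2 := by nlinarith [Real.sin_sq_add_cos_sq s]
  have st : Real.sin t ^ 2 = 1 - Real.cos t ^ 2 := by nlinarith [Real.sin_sq_add_cos_sq t]
  rw [← ss, ← st] at hk
  simp only [liouville, liouvilleDeriv]
  set P := jacobiPolynomial α β N
  set As := liouvilleAmp α β s
  set At := liouvilleAmp α β t
  set p := eval (Real.cos s) P
  set q := eval (Real.cos t) P
  linear_combination (As * At) * hk + (As * At * p * q) * (wt - ws)

theorem half_le_sin {θ : ℝ} (h : θ ∈ Set.Icc (1 : ℝ) 2) : 1 / 2 ≤ Real.sin θ := by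
  have h1 := Real.sin_gt_sub_cube (x := θ) (by linarith [h.1])
  nlinarith [h.1, h.2, mul_nonneg (sub_nonneg.2 h.1) (sub_nonneg.2 h.2)]

theorem exists_liouville_jacobiKernel_bound {α β : ℝ} (hα : -1 < α) (hβ : -1 < β) :
    ∃ M : ℝ, ∀ N : ℕ, M ≤ N → ∀ s ∈ Set.Icc (1 : ℝ) 2, ∀ t ∈ Set.Icc (1 : ℝ) 2,
      |(Real.cos s - Real.cos t) * (liouvilleAmp α β s * liouvilleAmp α β t *
          jacobiKernel α β N (Real.cos s) (Real.cos t)) +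
        Real.sin t * (Real.sin ((N + (α + β + 1) / 2) * (s - t)) / Real.pi)| ≤ 4 * |s - t| := by
  obtain ⟨M, hM, hw⟩ := exists_liouville_wronskian_bound hα hβ
  -- α + β > -2 gives ρ > N - 1/2 ≥ M.
  refine ⟨M + 1 / 2, fun N hN s hs t ht => ?_⟩
  have hI : ∀ θ ∈ Set.Icc (1 : ℝ) 2, θ ∈ Set.Ioo 0 Real.pi := fun θ hθ =>
    ⟨by linarith [hθ.1], by linarith [hθ.2, Real.pi_gt_three]⟩
  have hN0 : 0 < N := by
    have : (0 : ℝ) < N := by linarith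
    exact_mod_cast this
  have hk := liouville_jacobiKernel_eq hα hβ hN0 (hI s hs) (hI t ht)
  have hh := jacobiNormSq_pos hα hβ N
  rw [jacobiNormSq_eq_functional hα hβ] at hk hh
  set ρ : ℝ := N + (α + β + 1) / 2 with hρ
  have hMρ : M ≤ ρ := by linarith
  obtain ⟨hb, hd⟩ := hw (jacobiPolynomial α β N) _ ρ (jacobiPolynomial_ode α β N)
    (by rw [hρ]; ring) hMρ hh.le
  have hd := hd s hs t ht
  set P := jacobiPolynomial α β N
  set h := jacobiFunctional hα hβ (P * P)
  set u := liouville α β P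
  set v := liouvilleDeriv α β P
  have hsh : √h * √h = h := Real.mul_self_sqrt hh.le
  have hρ0 : 0 < ρ := by linarith
  have huv : |u t * v s| ≤ 2 * ρ * h := by
    rw [abs_mul]
    refine (mul_le_mul (hb t ht).1 (hb s hs).2 (abs_nonneg _) (by positivity)).trans ?_
    exact le_of_eq (by linear_combination (2 * ρ) * hsh)
  have huu : |u s * u t| ≤ 4 * h := by
    rw [abs_mul]
    refine (mul_le_mul (hb s hs).1 (hb t ht).1 (abs_nonneg _) (by positivity)).trans ?_
    exact le_of_eq (by linear_combination 4 * hsh)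
  set K := (Real.cos s - Real.cos t) * (liouvilleAmp α β s * liouvilleAmp α β t *
          jacobiKernel α β N (Real.cos s) (Real.cos t))
  have e : 2 * ρ * h * (K + Real.sin t * (Real.sin (ρ * (s - t)) / Real.pi)) =
      -Real.sin t * (u s * v t - u t * v s - 2 * ρ / Real.pi * Real.sin (ρ * (s - t)) * h) +
      (Real.sin s - Real.sin t) * (u t * v s) +
      -(ρ * ((Real.cos s - Real.cos t) * (u s * u t))) := by
    rw [hρ] at hk ⊢
    linear_combination hk
  have b1 : |-Real.sin t * (u s * v t - u t * v s -
      2 * ρ / Real.pi * Real.sin (ρ * (s - t)) * h)| ≤ ρ * h * |s - t| := by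
    rw [abs_mul, abs_neg]
    refine (mul_le_of_le_one_left (abs_nonneg _) (Real.abs_sin_le_one _)).trans (hd.trans ?_)
    gcongr
  have b2 : |(Real.sin s - Real.sin t) * (u t * v s)| ≤ |s - t| * (2 * ρ * h) := by
    rw [abs_mul]
    exact mul_le_mul (Real.abs_sin_sub_sin_le s t) huv (abs_nonneg _) (abs_nonneg _)
  have b3 : |-(ρ * ((Real.cos s - Real.cos t) * (u s * u t)))| ≤ ρ * (|s - t| * (4 * h)) := by
    rw [abs_neg, abs_mul, abs_mul (Real.cos s - _), abs_of_pos hρ0]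
    refine mul_le_mul_of_nonneg_left ?_ hρ0.le
    exact mul_le_mul (Real.abs_cos_sub_cos_le s t) huu (abs_nonneg _) (abs_nonneg _)
  have hpos : 0 < 2 * ρ * h := by positivity
  -- The three errors total at most (1 + 2 + 4)ρh|s-t|, below 2ρh · 4|s-t|.
  refine le_of_mul_le_mul_left (a := 2 * ρ * h) ?_ hpos
  rw [← abs_of_pos hpos, ← abs_mul, abs_of_pos hpos, e]
  refine (abs_add_three _ _ _).trans ?_
  have : 0 ≤ ρ * h * |s - t| := by positivity
  linarith

/-! ### From the Jacobi kernel to the orthogonal ensemble -/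

theorem joeKernel_eq_jacobiKernel {a b : ℝ} (ha : -2 < a) (hb : -2 < b) (N : ℕ) (x y : ℝ) :
    joeKernel a b N x y = (1 - x ^ 2) * ((1 - x) ^ (a / 2) * (1 + x) ^ (b / 2)) *
      ((1 - y) ^ (a / 2) * (1 + y) ^ (b / 2)) * jacobiKernel (a + 1) (b + 1) N x y := by
  rw [joeKernel, jacobiKernel, Finset.mul_sum]
  refine Finset.sum_congr rfl fun j _ => ?_
  have hh := jacobiNormSq_pos (by linarith : -1 < a + 1) (by linarith : -1 < b + 1) j
  have hs := Real.mul_self_sqrt hh.le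
  have hs0 : √(jacobiNormSq (a + 1) (b + 1) j) ≠ 0 := (Real.sqrt_pos.2 hh).ne'
  rw [joePhi, joePhi, eval_jacobiPolynomial, eval_jacobiPolynomial]
  conv_rhs => rw [← hs]
  field_simp

theorem liouvilleAmp_eq_mul_sin (a b : ℝ) {θ : ℝ} (h : θ ∈ Set.Ioo 0 Real.pi) :
    liouvilleAmp (a + 1) (b + 1) θ =
      (1 - Real.cos θ) ^ (a / 2) * (1 + Real.cos θ) ^ (b / 2) * (Real.sin θ * √(Real.sin θ)) := by
  have p1 := one_sub_cos_pos h
  have p2 := one_add_cos_pos h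
  have hs0 := Real.sin_pos_of_pos_of_lt_pi h.1 h.2
  have hs : Real.sin θ * √(Real.sin θ) =
      (1 - Real.cos θ) ^ (3 / 4 : ℝ) * (1 + Real.cos θ) ^ (3 / 4 : ℝ) := by
    rw [← Real.mul_rpow p1.le p2.le, show (1 - Real.cos θ) * (1 + Real.cos θ) = Real.sin θ ^ 2 by
      nlinarith [Real.sin_sq_add_cos_sq θ], ← Real.rpow_natCast_mul hs0.le, Real.sqrt_eq_rpow,
      ← Real.rpow_one_add' hs0.le (by norm_num)]
    norm_num
  rw [liouvilleAmp, hs, show (a + 1 + 1 / 2) / 2 = a / 2 + 3 / 4 by ring,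
    show (b + 1 + 1 / 2) / 2 = b / 2 + 3 / 4 by ring, Real.rpow_add p1, Real.rpow_add p2]
  ring

theorem exists_joeKernel_cos_bound {a b : ℝ} (ha : -2 < a) (hb : -2 < b) :
    ∃ M : ℝ, ∀ N : ℕ, M ≤ N → ∀ s ∈ Set.Icc (1 : ℝ) 2, ∀ t ∈ Set.Icc (1 : ℝ) 2,
      |(Real.cos s - Real.cos t) * joeKernel a b N (Real.cos s) (Real.cos t) +
        Real.sin ((N + (a + b + 3) / 2) * (s - t)) / Real.pi| ≤ 18 * |s - t| := by
  obtain ⟨M, hM⟩ := exists_liouville_jacobiKernel_bound (by linarith : -1 < a + 1)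
    (by linarith : -1 < b + 1)
  refine ⟨M, fun N hN s hs t ht => ?_⟩
  have hI : ∀ θ ∈ Set.Icc (1 : ℝ) 2, θ ∈ Set.Ioo 0 Real.pi := fun θ hθ =>
    ⟨by linarith [hθ.1], by linarith [hθ.2, Real.pi_gt_three]⟩
  have hk := hM N hN s hs t ht
  rw [show (a + 1 + (b + 1) + 1) / 2 = (a + b + 3) / 2 by ring] at hk
  rw [liouvilleAmp_eq_mul_sin a b (hI s hs), liouvilleAmp_eq_mul_sin a b (hI t ht)] at hk
  rw [joeKernel_eq_jacobiKernel ha hb, show 1 - Real.cos s ^ 2 = Real.sin s ^ 2 by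
    nlinarith [Real.sin_sq_add_cos_sq s]]
  have hss := half_le_sin hs
  have hst := half_le_sin ht
  have hsub := Real.abs_sin_sub_sin_le s t
  set σ := Real.sin ((N + (a + b + 3) / 2) * (s - t)) / Real.pi
  have hσ : |σ| ≤ 1 := by
    rw [abs_div, abs_of_pos Real.pi_pos]
    exact div_le_one_of_le₀ ((Real.abs_sin_le_one _).trans (by linarith [Real.pi_gt_three]))
      Real.pi_pos.le
  set S := Real.sin s
  set T := Real.sin t
  set Gs := (1 - Real.cos s) ^ (a / 2) * (1 + Real.cos s) ^ (b / 2)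
  set Gt := (1 - Real.cos t) ^ (a / 2) * (1 + Real.cos t) ^ (b / 2)
  set K := jacobiKernel (a + 1) (b + 1) N (Real.cos s) (Real.cos t)
  have hS2 : √S ^ 2 = S := Real.sq_sqrt (by linarith)
  have hT2 : √T ^ 2 = T := Real.sq_sqrt (by linarith)
  have hS1 : 1 / 2 ≤ √S := Real.le_sqrt_of_sq_le (by norm_num; linarith)
  have hT1 : 1 / 2 ≤ √T := Real.le_sqrt_of_sq_le (by norm_num; linarith)
  have hS3 : √S ≤ 1 := Real.sqrt_le_one.2 (Real.sin_le_one s)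
  set p := √S
  set q := √T
  have hp0 : 0 < p := by linarith
  have hq0 : 0 < q := by linarith
  have hT0 : 0 < T := by linarith
  -- The ensemble kernel carries sin² s, the Liouville form sin^(3/2) s · sin^(3/2) t. The ratio is
  -- bounded by 4, and its deviation from the needed value costs at most 2|s-t|; hence 18 = 4·4 + 2.
  have e : (Real.cos s - Real.cos t) * (S ^ 2 * Gs * Gt * K) + σ =
      p / (T * q) * ((Real.cos s - Real.cos t) * (Gs * (S * p) * (Gt * (T * q)) * K) + T * σ) +
        (q - p) / q * σ := by
    rw [← hS2]
    field_simp
    ring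
  rw [e]
  have c1 : p / (T * q) ≤ 4 := by
    rw [div_le_iff₀ (by positivity)]
    nlinarith
  have c2 : |(q - p) / q| ≤ 2 * |s - t| := by
    rw [abs_div, abs_of_pos hq0, div_le_iff₀ hq0]
    have h1 : |q - p| * (p + q) ≤ |s - t| := by
      rw [← abs_of_pos (by positivity : 0 < p + q), ← abs_mul,
        show (q - p) * (p + q) = -(S - T) by rw [← hS2, ← hT2]; ring, abs_neg]
      exact hsub
    have h2 : |q - p| * 1 ≤ |q - p| * (p + q) := by gcongr; linarith
    have h3 : |s - t| * (1 / 2) ≤ |s - t| * q := by gcongr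
    linarith
  refine (abs_add_le _ _).trans ?_
  rw [abs_mul, abs_mul ((q - p) / q), abs_of_pos (by positivity : 0 < p / (T * q))]
  have d1 := mul_le_mul c1 hk (abs_nonneg _) (by norm_num)
  have d2 := mul_le_mul c2 hσ (abs_nonneg _) (by positivity)
  linarith

/-! ### Rescaling at the origin and the limit -/

theorem abs_arccos_sub_half_pi_le {z : ℝ} (h1 : -1 ≤ z) (h2 : z ≤ 1) :
    |Real.arccos z - Real.pi / 2| ≤ 2 * |z| := by
  rw [Real.arccos, sub_right_comm, sub_self, zero_sub, abs_neg]
  have hm := Real.arcsin_mem_Icc z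
  have h := Real.mul_abs_le_abs_sin (x := Real.arcsin z) (abs_le.2 hm)
  rw [Real.sin_arcsin h1 h2] at h
  have : 1 / 2 ≤ 2 / Real.pi := by
    rw [div_le_div_iff₀ (by norm_num) Real.pi_pos]
    linarith [Real.pi_lt_four]
  have := mul_le_mul_of_nonneg_right this (abs_nonneg (Real.arcsin z))
  linarith

/-- Near π/2 the derivative 1 - sin θ of cos θ + θ is at most δ²/2 ≤ δ. -/
theorem abs_cos_sub_cos_add_sub_le {δ s t : ℝ} (hδ : δ ≤ 1)
    (hs : |s - Real.pi / 2| ≤ δ) (ht : |t - Real.pi / 2| ≤ δ) :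
    |Real.cos s - Real.cos t + (s - t)| ≤ δ * |s - t| := by
  have hmem : ∀ θ : ℝ, |θ - Real.pi / 2| ≤ δ → θ ∈ Set.Icc (Real.pi / 2 - δ) (Real.pi / 2 + δ) := by
    intro θ hθ
    have := abs_le.1 hθ
    exact ⟨by linarith, by linarith⟩
  have hm := (convex_Icc (Real.pi / 2 - δ) (Real.pi / 2 + δ)).norm_image_sub_le_of_norm_hasDerivWithin_le
    (f := fun θ => Real.cos θ + θ) (f' := fun θ => -Real.sin θ + 1) (C := δ)
    (fun θ _ => ((Real.hasDerivAt_cos θ).add (hasDerivAt_id θ)).hasDerivWithinAt) ?_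
    (hmem t ht) (hmem s hs)
  · simp only [Real.norm_eq_abs] at hm
    convert hm using 2
    ring
  · intro θ hθ
    have hc := Real.one_sub_sq_div_two_le_cos (x := θ - Real.pi / 2)
    rw [Real.cos_sub_pi_div_two] at hc
    have : |θ - Real.pi / 2| ≤ δ := abs_le.2 ⟨by linarith [hθ.1], by linarith [hθ.2]⟩
    have h2 := pow_le_pow_left₀ (abs_nonneg _) this 2
    rw [sq_abs] at h2
    have h0 := (abs_nonneg _).trans this
    rw [Real.norm_eq_abs, abs_of_nonneg (by linarith [Real.sin_le_one θ])]
    nlinarith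

theorem sineKernel_eq_sinc (x y : ℝ) : sineKernel x y = Real.sinc (x - y) / Real.pi := by
  rw [sineKernel]
  split_ifs with h
  · simp [h]
  · rw [Real.sinc_of_ne_zero (sub_ne_zero.2 h), div_div, mul_comm]

theorem continuousAt_joeKernel (a b : ℝ) (N : ℕ) {x : ℝ} (y : ℝ) (hx : x ∈ Set.Ioo (-1 : ℝ) 1) :
    ContinuousAt (fun z => joeKernel a b N z y) x := by
  have h1 : 1 - x ≠ 0 := by linarith [hx.2]
  have h2 : 1 + x ≠ 0 := by linarith [hx.1]
  have c1 : ContinuousAt (fun z : ℝ => (1 - z) ^ (a / 2)) x :=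
    ContinuousAt.rpow_const (by fun_prop) (Or.inl h1)
  have c2 : ContinuousAt (fun z : ℝ => (1 + z) ^ (b / 2)) x :=
    ContinuousAt.rpow_const (by fun_prop) (Or.inl h2)
  have c3 : ∀ j, ContinuousAt (fun z => joePhi a b j z) x := by
    intro j
    have c0 : ContinuousAt (fun z : ℝ => jacobiPoly (a + 1) (b + 1) j z) x := by
      simp only [← eval_jacobiPolynomial]
      exact (jacobiPolynomial (a + 1) (b + 1) j).continuousAt
    exact ((c0.div_const _).mul c1).mul c2
  have c4 : ContinuousAt (fun z : ℝ => 1 - z ^ 2) x := by fun_prop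
  exact tendsto_finsetSum _ fun j _ => (c4.mul (c3 j)).mul continuousAt_const

/-- The bound off the diagonal, multiplied through by `x - y`. -/
theorem exists_joeKernel_sub_sin_bound {a b : ℝ} (ha : -2 < a) (hb : -2 < b) {R : ℝ} (hR : 1 ≤ R) :
    ∃ C : ℝ, ∃ N₀ : ℕ, ∀ N : ℕ, N₀ ≤ N → R < N ∧ ∀ x y : ℝ, |x| ≤ R → |y| ≤ R →
      |(x - y) * (1 / (N : ℝ) * joeKernel a b N (x / N) (y / N)) -
        Real.sin (x - y) / Real.pi| ≤ C / N * |x - y| := by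
  obtain ⟨M, hM⟩ := exists_joeKernel_cos_bound ha hb
  set κ := |(a + b + 3) / 2| with hκ
  -- 36 is 18 times the factor 2 in |s-t| ≤ 2|x-y|/N, and 8R + κ bounds the phase error. The
  -- threshold on N gives 2R/N ≤ 1/4 and |ρ| ≤ 2N.
  refine ⟨36 + 8 * R + κ, ⌈max M (8 * R + κ)⌉₊, fun N hN => ?_⟩
  have hN1 : max M (8 * R + κ) ≤ N := (Nat.le_ceil _).trans (by exact_mod_cast hN)
  have hNM : M ≤ N := (le_max_left _ _).trans hN1
  have hNR : 8 * R + κ ≤ N := (le_max_right _ _).trans hN1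
  have hκ0 : 0 ≤ κ := abs_nonneg _
  have hN0 : (0 : ℝ) < N := by linarith
  refine ⟨by linarith, fun x y hx hy => ?_⟩
  set δ := 2 * R / N with hδ
  have hδ4 : δ ≤ 1 / 4 := by
    rw [hδ, div_le_iff₀ hN0]; linarith
  have harc : ∀ z : ℝ, |z| ≤ R → Real.cos (Real.arccos (z / N)) = z / N ∧
      |Real.arccos (z / N) - Real.pi / 2| ≤ δ ∧ Real.arccos (z / N) ∈ Set.Icc (1 : ℝ) 2 := by
    intro z hz
    have hzN : |z / N| ≤ R / N := by
      rw [abs_div, abs_of_pos hN0]; gcongr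
    have hRN : R / N ≤ 1 := by rw [div_le_one hN0]; linarith
    obtain ⟨h1, h2⟩ := abs_le.1 (hzN.trans hRN)
    have h3 := abs_arccos_sub_half_pi_le h1 h2
    have h4 : |Real.arccos (z / N) - Real.pi / 2| ≤ δ := by
      refine h3.trans ?_
      rw [hδ, mul_div_assoc]
      linarith
    obtain ⟨h5, h6⟩ := abs_le.1 h4
    exact ⟨Real.cos_arccos h1 h2, h4, by linarith [Real.pi_gt_three], by linarith [Real.pi_lt_d2]⟩
  obtain ⟨cx, dx, ix⟩ := harc x hx
  obtain ⟨cy, dy, iy⟩ := harc y hy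
  set s := Real.arccos (x / N)
  set t := Real.arccos (y / N)
  have hk := hM N hNM s ix t iy
  have hst := abs_cos_sub_cos_add_sub_le (by linarith) dx dy
  rw [cx, cy] at hk hst
  set X := x / N with hX
  set Y := y / N with hY
  have hXY : |X - Y| = |x - y| / N := by
    rw [hX, hY, ← sub_div, abs_div, abs_of_pos hN0]
  have hle : |s - t| ≤ 2 * |X - Y| := by
    have h1 : |s - t| ≤ |X - Y + (s - t)| + |X - Y| := by
      have := abs_sub (X - Y + (s - t)) (X - Y)
      rwa [add_sub_cancel_left] at this
    have h2 := mul_le_mul_of_nonneg_right hδ4 (abs_nonneg (s - t))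
    linarith [abs_nonneg (X - Y)]
  have hρ : |(N + (a + b + 3) / 2 : ℝ)| ≤ 2 * N := by
    refine (abs_add_le _ _).trans ?_
    rw [abs_of_pos hN0]
    linarith
  -- The phase ρ(s-t) equals -(x-y) up to O(|x-y|/N): the factor N in ρ is absorbed by δ = 2R/N.
  have hdiff : |(N + (a + b + 3) / 2) * (s - t) + (x - y)| ≤ (8 * R + κ) * |X - Y| := by
    have e : (N + (a + b + 3) / 2) * (s - t) + (x - y) =
        (N + (a + b + 3) / 2) * (X - Y + (s - t)) - (a + b + 3) / 2 * (X - Y) := by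
      rw [hX, hY]
      field_simp
      ring
    rw [e]
    refine (abs_sub _ _).trans ?_
    rw [abs_mul, abs_mul]
    have h1 := mul_le_mul hρ (hst.trans (mul_le_mul_of_nonneg_left hle (by positivity)))
      (abs_nonneg _) (by positivity)
    have e2 : 2 * (N : ℝ) * (δ * (2 * |X - Y|)) = 8 * R * |X - Y| := by
      rw [hδ]; field_simp; ring
    rw [e2] at h1
    linarith
  have hsin : |Real.sin ((N + (a + b + 3) / 2) * (s - t)) / Real.pi + Real.sin (x - y) / Real.pi| ≤
      (8 * R + κ) * |X - Y| := by
    rw [← add_div, abs_div, abs_of_pos Real.pi_pos]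
    refine (div_le_self (abs_nonneg _) (by linarith [Real.pi_gt_three])).trans ?_
    have := Real.abs_sin_sub_sin_le ((N + (a + b + 3) / 2) * (s - t)) (-(x - y))
    rw [Real.sin_neg, sub_neg_eq_add, sub_neg_eq_add] at this
    exact this.trans hdiff
  have e : (x - y) * (1 / (N : ℝ) * joeKernel a b N X Y) - Real.sin (x - y) / Real.pi =
      ((X - Y) * joeKernel a b N X Y + Real.sin ((N + (a + b + 3) / 2) * (s - t)) / Real.pi) -
      (Real.sin ((N + (a + b + 3) / 2) * (s - t)) / Real.pi + Real.sin (x - y) / Real.pi) := by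
    rw [show (x - y) * (1 / (N : ℝ) * joeKernel a b N X Y) = (X - Y) * joeKernel a b N X Y by
      rw [hX, hY]; ring]
    ring
  rw [e]
  refine (abs_sub _ _).trans ?_
  have : (36 + 8 * R + κ) / N * |x - y| = (36 + 8 * R + κ) * |X - Y| := by
    rw [hXY]; ring
  rw [this]
  linarith

theorem mainTheorem9 (a b : ℝ) (ha : -2 < a) (hb : -2 < b) (K : Set ℝ) (hK : IsCompact K) :
    ∃ C : ℝ, ∃ N₀ : ℕ, ∀ N : ℕ, N₀ ≤ N → 0 < N → ∀ x ∈ K, ∀ y ∈ K,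
      |1 / (N : ℝ) * joeKernel a b N (x / N) (y / N) - sineKernel x y| ≤ C / N := by
  obtain ⟨R, hR⟩ := hK.isBounded.exists_norm_le
  -- The extra 1 in the radius lets the first variable move off the diagonal in a unit ball.
  obtain ⟨C, N₀, h⟩ := exists_joeKernel_sub_sin_bound ha hb (R := |R| + 1)
    (by linarith [abs_nonneg R])
  refine ⟨C, N₀, fun N hN hN0 x hx y hy => ?_⟩
  obtain ⟨hRN, h⟩ := h N hN
  have hNpos : (0 : ℝ) < N := by exact_mod_cast hN0
  have hKR : ∀ z ∈ K, |z| ≤ |R| := fun z hz => (hR z hz).trans (le_abs_self R)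
  have hoff : ∀ z : ℝ, |z| ≤ |R| + 1 → z ≠ y →
      |1 / (N : ℝ) * joeKernel a b N (z / N) (y / N) - Real.sinc (z - y) / Real.pi| ≤ C / N := by
    intro z hz hzy
    have hne : z - y ≠ 0 := sub_ne_zero.2 hzy
    have := h z y hz ((hKR y hy).trans (by linarith))
    rw [show Real.sin (z - y) / Real.pi = (z - y) * (Real.sinc (z - y) / Real.pi) by
      rw [Real.sinc_of_ne_zero hne]; field_simp, ← mul_sub, abs_mul, mul_comm] at this
    exact le_of_mul_le_mul_right this (abs_pos.2 hne)
  rw [sineKernel_eq_sinc]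
  by_cases hxy : x = y
  -- The off-diagonal bound is uniform in z ≠ x, so it survives the limit z → x by continuity of the
  -- kernel and of sinc.
  · subst hxy
    have hx' : |x / N| < 1 := by
      rw [abs_div, abs_of_pos hNpos, div_lt_one hNpos]
      linarith [hKR x hx]
    have hcont : ContinuousAt (fun z : ℝ => |1 / (N : ℝ) * joeKernel a b N (z / N) (x / N) -
        Real.sinc (z - x) / Real.pi|) x := by
      have c1 : ContinuousAt (fun z : ℝ => joeKernel a b N (z / N) (x / N)) x :=
        ContinuousAt.comp (f := fun z : ℝ => z / N) (g := fun z => joeKernel a b N z (x / N))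
          (continuousAt_joeKernel a b N (x / N) (abs_lt.1 hx')) (by fun_prop)
      have c2 : ContinuousAt (fun z : ℝ => Real.sinc (z - x)) x :=
        (Real.continuous_sinc.comp (continuous_sub_right x)).continuousAt
      fun_prop
    refine le_of_tendsto (hcont.tendsto.mono_left (nhdsWithin_le_nhds (s := {x}ᶜ))) ?_
    filter_upwards [self_mem_nhdsWithin, nhdsWithin_le_nhds (Metric.ball_mem_nhds x one_pos)]
      with z hz hzb
    refine hoff z ?_ hz
    rw [Metric.mem_ball, Real.dist_eq] at hzb
    have := abs_add_le (z - x) x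
    rw [sub_add_cancel] at this
    linarith [hKR x hx]
  · exact hoff x ((hKR x hx).trans (by linarith)) hxy
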